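/- Let $n\ge 3$ and $2\le k\le n$ be integers, and for $z\in\mathbb R^n=\mathbb R^k\times\mathbb R^{n-k}$ write $z=(x,y)$ with $x\in\mathbb R^k$, $y\in\mathbb R^{n-k}$. Let $1<p<n$, $0\le s<p$, $s<k$ and $s(n-k)<k(n-p)$, and put $$p^*=\frac{np}{n-p},\qquad p'=\frac{p}{p-1},\qquad p^*(s)=\frac{p(n-s)}{n-p},\qquad r'=\frac{p^*}{p^*(s)-p}.$$ Let $\Omega\subseteq\mathbb R^n$ be an open set, not necessarily bounded, and let $\mathcal D^{1,p}(\Omega)$ be the closure of $C_o^\infty(\Omega)$ with respect to the norm $\|\nabla u\|_{L^p}$. Suppose $R\in L^{r'}(\Omega)$ and $V_o\in L^1(\Omega)\cap L^{r'}(\Omega)$, and, in the case $p>2$, assume also $R\ge 0$ and $V_o\ge 0$. Let $u\in\mathcal D^{1,p}(\Omega)$ be a non-negative function, (essentially) bounded on every compact subset of $\Omega$, which is a weak solution of $$-\operatorname{div}\bigl(|\nabla u|^{p-2}\nabla u\bigr)\ \le\ R\,\frac{|u|^{p-2}}{|x|^s}\,u+V_o\quad\text{in }\Omega,$$ that is,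 $$\int_\Omega |\nabla u|^{p-2}\langle\nabla u,\nabla\phi\rangle\,dz\ \le\ \int_\Omega\Bigl(R\,\frac{|u|^{p-2}}{|x|^s}\,u+V_o\Bigr)\phi\,dz\qquad\text{for every } 0\le\phi\in C_o^\infty(\Omega).$$ Then $u\in L^q(\Omega)$ for every $q$ with $\dfrac{p^*}{p'}<q\le p^*$. -/

import Mathlib

open MeasureTheory Filter Topology

noncomputable section

/-- The Sobolev conjugate exponent `p* = np/(n-p)`. -/
def sobolevConj (n : ℕ) (p : ℝ) : ℝ := (n : ℝ) * p / ((n : ℝ) - p)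

/-- The Hardy–Sobolev conjugate exponent `p*(s) = p(n-s)/(n-p)`. -/
def hardySobolevConj (n : ℕ) (p s : ℝ) : ℝ := p * ((n : ℝ) - s) / ((n : ℝ) - p)

/-- The exponent `r' = p*/(p*(s) - p)`; it is a positive real number for `0 ≤ s < p < n`. -/
def rPrime (n : ℕ) (p s : ℝ) : ℝ := sobolevConj n p / (hardySobolevConj n p s - p)

/-- The Hölder conjugate `p' = p/(p-1)`. -/
def holderConj (p : ℝ) : ℝ := p / (p - 1)

/-- For `z = (x, y)` in `ℝⁿ = ℝᵏ × ℝⁿ⁻ᵏ`, the Euclidean norm `|x|` of the first `k` coordinates. -/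
def cylNorm {n : ℕ} (k : ℕ) (z : EuclideanSpace ℝ (Fin n)) : ℝ :=
  Real.sqrt (∑ i : Fin n with i.val < k, z i ^ 2)

/-- `φ ∈ C_o^∞(Ω)`. -/
structure IsTestFunction {n : ℕ} (Ω : Set (EuclideanSpace ℝ (Fin n)))
    (φ : EuclideanSpace ℝ (Fin n) → ℝ) : Prop where
  smooth : ContDiff ℝ ((⊤ : ℕ∞) : WithTop ℕ∞) φ
  compact : HasCompactSupport φ
  supp : tsupport φ ⊆ Ω

/-- `G` is the weak (distributional) gradient of `u` in `Ω`. -/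
structure IsWeakGradient {n : ℕ} (Ω : Set (EuclideanSpace ℝ (Fin n)))
    (u : EuclideanSpace ℝ (Fin n) → ℝ)
    (G : EuclideanSpace ℝ (Fin n) → EuclideanSpace ℝ (Fin n)) : Prop where
  locInt : LocallyIntegrableOn u Ω
  locIntGrad : LocallyIntegrableOn G Ω
  byParts : ∀ φ : EuclideanSpace ℝ (Fin n) → ℝ, IsTestFunction Ω φ → ∀ i : Fin n,
    ∫ z in Ω, u z * gradient φ z i = - ∫ z in Ω, G z i * φ z

/-- `u` belongs to `D^{1,p}(Ω)`, the closure of `C_o^∞(Ω)` in the norm `‖∇u‖_{L^p}`, and `G` is its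
weak gradient. The elements of the closure are realised as functions on `Ω`, as limits in
`L^1_loc(Ω)` of test functions whose gradients converge in `L^p` (for `1 ≤ p < n` the limit function
is determined by the limit of the gradients, by the Sobolev inequality). -/
structure IsD1p {n : ℕ} (Ω : Set (EuclideanSpace ℝ (Fin n))) (p : ℝ)
    (u : EuclideanSpace ℝ (Fin n) → ℝ)
    (G : EuclideanSpace ℝ (Fin n) → EuclideanSpace ℝ (Fin n)) : Prop where
  weakGrad : IsWeakGradient Ω u G
  memLp : MemLp G (ENNReal.ofReal p) (volume.restrict Ω)
  approx : ∃ φ : ℕ → EuclideanSpace ℝ (Fin n) → ℝ, (∀ j, IsTestFunction Ω (φ j)) ∧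
    (∀ K : Set (EuclideanSpace ℝ (Fin n)), IsCompact K → K ⊆ Ω →
      Tendsto (fun j => eLpNorm (fun z => φ j z - u z) 1 (volume.restrict K)) atTop (𝓝 0)) ∧
    Tendsto (fun j => eLpNorm (fun z => gradient (φ j) z - G z) (ENNReal.ofReal p)
      (volume.restrict Ω)) atTop (𝓝 0)

/-- `u ∈ D^{1,p}(Ω)` is a weak solution of the inequality
`-div(|∇u|^{p-2}∇u) ≤ R |u|^{p-2}u/|x|^s + V₀` in `Ω`. -/
def IsWeakSubsolution {n : ℕ} (Ω : Set (EuclideanSpace ℝ (Fin n))) (k : ℕ) (p s : ℝ)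
    (R V₀ u : EuclideanSpace ℝ (Fin n) → ℝ) : Prop :=
  ∃ G : EuclideanSpace ℝ (Fin n) → EuclideanSpace ℝ (Fin n), IsD1p Ω p u G ∧
    ∀ φ : EuclideanSpace ℝ (Fin n) → ℝ, IsTestFunction Ω φ → (∀ z, 0 ≤ φ z) →
      ∫ z in Ω, ‖G z‖ ^ (p - 2) * inner ℝ (G z) (gradient φ z) ≤
        ∫ z in Ω, (R z * (|u z| ^ (p - 2) / cylNorm k z ^ s) * u z + V₀ z) * φ z

/-- `u` is (essentially) bounded on every compact subset of `Ω`. -/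
def IsLocallyBounded {n : ℕ} (Ω : Set (EuclideanSpace ℝ (Fin n)))
    (u : EuclideanSpace ℝ (Fin n) → ℝ) : Prop :=
  ∀ K : Set (EuclideanSpace ℝ (Fin n)), IsCompact K → K ⊆ Ω →
    ∃ C : ℝ, ∀ᵐ z ∂(volume.restrict K), |u z| ≤ C

end

/-!
Write `z = (x, y)`, `ω = |x|^{-s/p}` and let `G = ∇u`.

The tool is the Hardy–Sobolev inequality `‖ω w‖_q ≤ C ‖∇w‖_p` on `C¹_c`, with the exponent `q` for
which `1 / r' + p / q = 1` (`exists_hardySobolev_weight`). It comes from integrating `|w|^q` against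
the divergence of `(x, 0) / (ε + |x|²)^{τ/2}` (`hardy_regularized`): Hölder's inequality and the
Sobolev inequality then bound the weighted integral by a power of itself which is smaller than one
(`hardySobolev_regularized`). This requires `1 ≤ τ`; weights of order below one follow by
interpolation with the Sobolev inequality.

Both inequalities pass to `D^{1,p}(Ω)` and to functions `F ∘ u` (`IsGradLimit.eLpNorm_mul_le`,
`IsGradLimit.comp`), and they make the right side of the differential inequality continuous for the
norm `‖∇φ‖_p`. Hence one may test with `F(u)`, where `F(t) = (t² + d)^{a/2} - d^{a/2}` with
`0 < a ≤ 1` (`ofReal_integral_deriv_mul_le`); this `F` is smooth, non-negative and vanishes at `0`,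
so `F ∘ φ` is a test function whenever `φ` is one. Let `W` be the profile `powerProfile`, which
approximates `t^{(p-1+a)/p}` and satisfies `|W'|^p ≤ C F'` and `t^{p-1} F ≤ W^p`. Testing gives
`∫ F'(u) |G|^p ≤ ∫ |R| u^{p-1} F(u) / |x|^s + ∫ |V₀| F(u)`.
On `{0 < u < η}` the potential term is at most `‖R 1_{0<u<η}‖_{r'} ‖ω W(u)‖_q^p`, which is absorbed
by the left side when `η` is small, and on `{u ≥ η}` it is at most `η^{a-1} ∫ |R| u^p / |x|^s`,
which is finite. The energy is therefore bounded uniformly in `d` (`exists_energy_bound`). The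
Sobolev inequality for `W(u)` and Fatou's lemma as `d → 0` give integrability of `u` to the power
`p* (p - 1 + a) / p`, and these exponents fill `(p* / p', p*]` as `a` runs through `(0, 1]`.
-/

/-! ### The partial norm and its regularization -/

lemma cylNorm_nonneg {n : ℕ} (k : ℕ) (z : EuclideanSpace ℝ (Fin n)) : 0 ≤ cylNorm k z :=
  Real.sqrt_nonneg _

lemma cylNorm_sq {n : ℕ} (k : ℕ) (z : EuclideanSpace ℝ (Fin n)) :
    cylNorm k z ^ 2 = ∑ i : Fin n with i.val < k, z i ^ 2 :=
  Real.sq_sqrt (Finset.sum_nonneg fun _ _ => sq_nonneg _)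

lemma continuous_cylNorm {n : ℕ} (k : ℕ) :
    Continuous (cylNorm k : EuclideanSpace ℝ (Fin n) → ℝ) := by
  unfold cylNorm
  fun_prop

lemma contDiff_cylNorm_sq {n : ℕ} (k : ℕ) :
    ContDiff ℝ 1 (fun z : EuclideanSpace ℝ (Fin n) => cylNorm k z ^ 2) := by
  simp_rw [cylNorm_sq]
  fun_prop

lemma regularized_pos {n : ℕ} (k : ℕ) {ε : ℝ} (hε : 0 < ε) (z : EuclideanSpace ℝ (Fin n)) :
    0 < ε + cylNorm k z ^ 2 := by positivity

lemma contDiff_regularized_rpow {n : ℕ} (k : ℕ) {ε : ℝ} (hε : 0 < ε) (a : ℝ) :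
    ContDiff ℝ 1 (fun z : EuclideanSpace ℝ (Fin n) => (ε + cylNorm k z ^ 2) ^ a) :=
  (contDiff_const.add (contDiff_cylNorm_sq k)).rpow_const_of_ne
    fun z => (regularized_pos k hε z).ne'

lemma hasFDerivAt_regularized_rpow {n : ℕ} (k : ℕ) {ε : ℝ} (hε : 0 < ε) (a : ℝ)
    (z : EuclideanSpace ℝ (Fin n)) :
    HasFDerivAt (fun z : EuclideanSpace ℝ (Fin n) => (ε + cylNorm k z ^ 2) ^ a)
      ((a * (ε + cylNorm k z ^ 2) ^ (a - 1)) •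
        ∑ i : Fin n with i.val < k,
          (2 * z i) • (EuclideanSpace.proj i : EuclideanSpace ℝ (Fin n) →L[ℝ] ℝ)) z := by
  have h1 : HasFDerivAt (fun z : EuclideanSpace ℝ (Fin n) => ε + cylNorm k z ^ 2)
      (∑ i : Fin n with i.val < k,
        (2 * z i) • (EuclideanSpace.proj i : EuclideanSpace ℝ (Fin n) →L[ℝ] ℝ)) z := by
    simp_rw [cylNorm_sq]
    refine HasFDerivAt.const_add _ (HasFDerivAt.fun_sum fun i _ => ?_)
    have := ((EuclideanSpace.proj i : EuclideanSpace ℝ (Fin n) →L[ℝ] ℝ).hasFDerivAt (x := z)).pow 2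
    simpa using this
  exact h1.rpow_const (Or.inl (regularized_pos k hε z).ne')

/-- Pointwise lower bound for the divergence of the field `z ↦ (x, 0) / (ε + |x|²)^{σ/2}`. -/
lemma sum_fderiv_field_ge {n k : ℕ} (hkn : k ≤ n) {ε σ : ℝ} (hε : 0 < ε) (hσ : 0 ≤ σ)
    (z : EuclideanSpace ℝ (Fin n)) :
    ((k : ℝ) - σ) * (ε + cylNorm k z ^ 2) ^ (-(σ / 2)) ≤
      ∑ i : Fin n with i.val < k,
        fderiv ℝ (fun z : EuclideanSpace ℝ (Fin n) => z i * (ε + cylNorm k z ^ 2) ^ (-(σ / 2))) z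
          (EuclideanSpace.single i 1) := by
  set Q := ε + cylNorm k z ^ 2 with hQ
  have hQ0 : 0 < Q := regularized_pos k hε z
  have hterm : ∀ i : Fin n, i.val < k →
      fderiv ℝ (fun z : EuclideanSpace ℝ (Fin n) => z i * (ε + cylNorm k z ^ 2) ^ (-(σ / 2))) z
          (EuclideanSpace.single i 1) = Q ^ (-(σ / 2)) - σ * Q ^ (-(σ / 2) - 1) * z i ^ 2 := by
    intro i hi
    have h1 := ((EuclideanSpace.proj i : EuclideanSpace ℝ (Fin n) →L[ℝ] ℝ).hasFDerivAt
      (x := z)).mul (hasFDerivAt_regularized_rpow k hε (-(σ / 2)) z)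
    have h2 : fderiv ℝ
        (fun z : EuclideanSpace ℝ (Fin n) => z i * (ε + cylNorm k z ^ 2) ^ (-(σ / 2))) z = _ :=
      h1.fderiv
    rw [h2]
    simp [hi, ← hQ]
    ring
  rw [Finset.sum_congr rfl fun i hi => hterm i (Finset.mem_filter.1 hi).2]
  have hcard : (Finset.univ.filter fun i : Fin n => i.val < k).card = k := by
    rw [Fin.card_filter_val_lt, min_eq_right hkn]
  rw [Finset.sum_sub_distrib, ← Finset.mul_sum, ← cylNorm_sq, Finset.sum_const, hcard,
    nsmul_eq_mul, sub_mul]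
  have h3 : Q ^ (-(σ / 2) - 1) * cylNorm k z ^ 2 ≤ Q ^ (-(σ / 2)) := by
    have : Q ^ (-(σ / 2)) = Q ^ (-(σ / 2) - 1) * Q := by
      rw [← Real.rpow_add_one hQ0.ne']; congr 1; ring
    rw [this]
    gcongr
    linarith
  nlinarith

/-- Regularized `L¹` Hardy inequality in the first `k` variables, obtained by integrating
`g` against the divergence of `z ↦ (x, 0) / (ε + |x|²)^{σ/2}`. -/
lemma hardy_regularized {n k : ℕ} (hkn : k ≤ n) {ε σ : ℝ} (hε : 0 < ε) (hσ : 0 ≤ σ)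
    {g : EuclideanSpace ℝ (Fin n) → ℝ} (hg : ContDiff ℝ 1 g) (hgc : HasCompactSupport g)
    (hg0 : ∀ z, 0 ≤ g z) :
    ((k : ℝ) - σ) * ∫ z, g z * (ε + cylNorm k z ^ 2) ^ (-(σ / 2)) ≤
      ∫ z, ‖fderiv ℝ g z‖ * (ε + cylNorm k z ^ 2) ^ ((1 - σ) / 2) := by
  set S := Finset.univ.filter fun i : Fin n => i.val < k with hS
  set w : EuclideanSpace ℝ (Fin n) → ℝ := fun z => (ε + cylNorm k z ^ 2) ^ (-(σ / 2)) with hw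
  have hwC : ContDiff ℝ 1 w := contDiff_regularized_rpow k hε _
  set X : Fin n → EuclideanSpace ℝ (Fin n) → ℝ := fun i z => z i * w z with hX
  have hXC : ∀ i, ContDiff ℝ 1 (X i) := fun i => by
    have : ContDiff ℝ 1 (fun z : EuclideanSpace ℝ (Fin n) => z i) := by fun_prop
    exact this.mul hwC
  have hgC' := hg.continuous_fderiv one_ne_zero
  have hgc' : HasCompactSupport (fderiv ℝ g) := hgc.fderiv ℝ
  have hI1 : ∀ i, Integrable (fun z => fderiv ℝ g z (EuclideanSpace.single i 1) * X i z) := by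
    intro i
    refine Continuous.integrable_of_hasCompactSupport
      ((hgC'.clm_apply continuous_const).mul (hXC i).continuous) ?_
    exact (hgc.fderiv_apply ℝ _).mul_right
  have hI2 : ∀ i, Integrable (fun z => g z * fderiv ℝ (X i) z (EuclideanSpace.single i 1)) := by
    intro i
    refine Continuous.integrable_of_hasCompactSupport (hg.continuous.mul
      (((hXC i).continuous_fderiv one_ne_zero).clm_apply continuous_const)) hgc.mul_right
  have hI3 : ∀ i, Integrable (fun z => g z * X i z) := fun i =>
    (hg.continuous.mul (hXC i).continuous).integrable_of_hasCompactSupport hgc.mul_right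
  have hparts : ∀ i, ∫ z, g z * fderiv ℝ (X i) z (EuclideanSpace.single i 1) =
      -∫ z, fderiv ℝ g z (EuclideanSpace.single i 1) * X i z := fun i =>
    integral_mul_fderiv_eq_neg_fderiv_mul_of_integrable (hI1 i) (hI2 i) (hI3 i)
      (fun z _ => hg.differentiable one_ne_zero z) (fun z _ => (hXC i).differentiable one_ne_zero z)
  have hIw : Integrable (fun z => g z * w z) :=
    (hg.continuous.mul hwC.continuous).integrable_of_hasCompactSupport hgc.mul_right
  have hIr : Integrable (fun z => ‖fderiv ℝ g z‖ * (ε + cylNorm k z ^ 2) ^ ((1 - σ) / 2)) :=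
    (hgC'.norm.mul (contDiff_regularized_rpow k hε _).continuous).integrable_of_hasCompactSupport
      hgc'.norm.mul_right
  calc ((k : ℝ) - σ) * ∫ z, g z * w z
      = ∫ z, ((k : ℝ) - σ) * (g z * w z) := (integral_const_mul _ _).symm
    _ ≤ ∫ z, ∑ i ∈ S, g z * fderiv ℝ (X i) z (EuclideanSpace.single i 1) := by
        refine integral_mono (hIw.const_mul _) (integrable_finsetSum _ fun i _ => hI2 i) ?_
        intro z
        have := mul_le_mul_of_nonneg_left (sum_fderiv_field_ge hkn hε hσ z) (hg0 z)
        simp only [← Finset.mul_sum]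
        calc _ = g z * (((k : ℝ) - σ) * (ε + cylNorm k z ^ 2) ^ (-(σ / 2))) := by ring
          _ ≤ _ := this
    _ = ∫ z, ∑ i ∈ S, -(fderiv ℝ g z (EuclideanSpace.single i 1) * X i z) := by
        rw [integral_finsetSum _ fun i _ => hI2 i,
          integral_finsetSum (f := fun i z => -(fderiv ℝ g z (EuclideanSpace.single i 1) * X i z)) _
            fun i _ => (hI1 i).neg]
        exact Finset.sum_congr rfl fun i _ => by rw [hparts i, integral_neg]
    _ ≤ _ := by
        refine integral_mono (integrable_finsetSum _ fun i _ => (hI1 i).neg) hIr fun z => ?_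
        have hQ0 := regularized_pos k hε z
        set v : EuclideanSpace ℝ (Fin n) := ∑ i ∈ S, z i • EuclideanSpace.single i 1 with hv
        have h1 : ∑ i ∈ S, -(fderiv ℝ g z (EuclideanSpace.single i 1) * X i z) =
            -(fderiv ℝ g z v) * w z := by
          rw [hv, map_sum, neg_mul, Finset.sum_mul, ← Finset.sum_neg_distrib]
          refine Finset.sum_congr rfl fun i _ => ?_
          simp only [hX, map_smul, smul_eq_mul]
          ring
        have hvn : ‖v‖ = cylNorm k z := by
          rw [EuclideanSpace.norm_eq, cylNorm]
          congr 1
          rw [Finset.sum_filter]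
          refine Finset.sum_congr rfl fun j _ => ?_
          have : v j = if j.val < k then z j else 0 := by
            simp [hv, hS, Finset.sum_apply, Pi.single_apply, Finset.sum_ite_eq]
          rw [this]
          split_ifs <;> simp
        have h2 : ‖v‖ ≤ (ε + cylNorm k z ^ 2) ^ ((1 : ℝ) / 2) := by
          rw [hvn, ← Real.sqrt_eq_rpow]
          exact Real.le_sqrt_of_sq_le (by linarith)
        have h3 : (ε + cylNorm k z ^ 2) ^ ((1 - σ) / 2) =
            (ε + cylNorm k z ^ 2) ^ ((1 : ℝ) / 2) * w z := by
          rw [hw, ← Real.rpow_add hQ0]; congr 1; ring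
        simp only [h1, h3]
        rw [← mul_assoc]
        refine mul_le_mul_of_nonneg_right ?_ (Real.rpow_nonneg hQ0.le _)
        calc -(fderiv ℝ g z v) ≤ ‖fderiv ℝ g z v‖ := by
              rw [Real.norm_eq_abs]; exact neg_le_abs _
          _ ≤ ‖fderiv ℝ g z‖ * ‖v‖ := ContinuousLinearMap.le_opNorm _ _
          _ ≤ _ := by gcongr

/-! ### The Hardy–Sobolev inequality with a cylindrical weight -/

/-- Hölder's inequality for three functions, in multiplicative form. -/
lemma lintegral_rpow_mul_rpow_mul_rpow_le {α : Type*} [MeasurableSpace α] {μ : Measure α}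
    {F G H : α → ENNReal} (hF : AEMeasurable F μ) (hG : AEMeasurable G μ) (hH : AEMeasurable H μ)
    {a b c : ℝ} (ha : 0 ≤ a) (hb : 0 ≤ b) (hc : 0 ≤ c) (habc : a + b + c = 1) :
    ∫⁻ z, F z ^ a * G z ^ b * H z ^ c ∂μ ≤
      (∫⁻ z, F z ∂μ) ^ a * (∫⁻ z, G z ∂μ) ^ b * (∫⁻ z, H z ∂μ) ^ c := by
  have := ENNReal.lintegral_prod_norm_pow_le (μ := μ) (Finset.univ : Finset (Fin 3))
    (f := ![F, G, H]) (p := ![a, b, c])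
    (by intro i _; fin_cases i <;> simpa) (by simpa [Fin.sum_univ_three] using habc)
    (by intro i _; fin_cases i <;> simpa)
  simpa [Fin.prod_univ_three] using this

lemma sobolev_fderiv {n : ℕ} {p : ℝ} (hp1 : 1 < p) (hpn : p < n) :
    ∃ S : ENNReal, S ≠ ⊤ ∧ ∀ w : EuclideanSpace ℝ (Fin n) → ℝ, ContDiff ℝ 1 w →
      HasCompactSupport w →
      eLpNorm w (ENNReal.ofReal (sobolevConj n p)) volume ≤
        S * eLpNorm (fderiv ℝ w) (ENNReal.ofReal p) volume := by
  have hn : 0 < (n : ℝ) := by linarith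
  have hq : 0 < sobolevConj n p := div_pos (by positivity) (by linarith)
  refine ⟨SNormLESNormFDerivOfEqConst ℝ (volume : Measure (EuclideanSpace ℝ (Fin n)))
    (p.toNNReal : ℝ), ENNReal.coe_ne_top, fun w hw hwc => ?_⟩
  have := eLpNorm_le_eLpNorm_fderiv_of_eq (μ := (volume : Measure (EuclideanSpace ℝ (Fin n))))
    hw hwc (p := p.toNNReal) (p' := (sobolevConj n p).toNNReal)
    (by rw [← NNReal.coe_le_coe, Real.coe_toNNReal _ (by linarith)]; exact hp1.le)
    (by rw [finrank_euclideanSpace_fin]; exact_mod_cast hn)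
    (by
      rw [Real.coe_toNNReal _ hq.le, NNReal.coe_inv, Real.coe_toNNReal p (by linarith),
        finrank_euclideanSpace_fin, sobolevConj]
      field_simp)
  exact this

lemma eLpNorm_ofReal_eq {α E : Type*} [MeasurableSpace α] [NormedAddCommGroup E] {μ : Measure α}
    (f : α → E) {p : ℝ} (hp : 0 < p) :
    eLpNorm f (ENNReal.ofReal p) μ = (∫⁻ z, ‖f z‖ₑ ^ p ∂μ) ^ (1 / p) := by
  rw [eLpNorm_eq_lintegral_rpow_enorm_toReal (by simpa using hp) ENNReal.ofReal_ne_top,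
    ENNReal.toReal_ofReal hp.le]

lemma eLpNorm_ofReal_rpow {α E : Type*} [MeasurableSpace α] [NormedAddCommGroup E] {μ : Measure α}
    (f : α → E) {p : ℝ} (hp : 0 < p) :
    eLpNorm f (ENNReal.ofReal p) μ ^ p = ∫⁻ z, ‖f z‖ₑ ^ p ∂μ := by
  rw [eLpNorm_ofReal_eq f hp, ← ENNReal.rpow_mul, one_div_mul_cancel hp.ne', ENNReal.rpow_one]

/-- Absorption: `I ≤ B * I ^ θ` with `0 ≤ θ < 1` and `I < ∞` bounds `I`. -/
lemma rpow_one_sub_le_of_le_mul_rpow {I B : ENNReal} {θ : ℝ} (hI : I ≠ ⊤) (hθ1 : θ < 1)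
    (h : I ≤ B * I ^ θ) : I ^ (1 - θ) ≤ B := by
  rcases eq_or_ne I 0 with h0 | h0
  · rw [h0, ENNReal.zero_rpow_of_pos (by linarith)]; exact zero_le
  · rw [ENNReal.rpow_sub _ _ h0 hI, ENNReal.rpow_one]
    exact ENNReal.div_le_of_le_mul h

/-- The `L¹` Hardy inequality applied to `|w|^q`, in terms of Lebesgue integrals. -/
lemma hardy_regularized_rpow {n k : ℕ} (hkn : k ≤ n) {ε σ q : ℝ} (hε : 0 < ε) (hσ : 0 ≤ σ)
    (hσk : σ < k) (hq : 1 < q)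
    {w : EuclideanSpace ℝ (Fin n) → ℝ} (hw : ContDiff ℝ 1 w) (hwc : HasCompactSupport w) :
    (∫⁻ z, ‖w z‖ₑ ^ q * ENNReal.ofReal (ε + cylNorm k z ^ 2) ^ (-(σ / 2)) ≠ ⊤) ∧
    ∫⁻ z, ‖w z‖ₑ ^ q * ENNReal.ofReal (ε + cylNorm k z ^ 2) ^ (-(σ / 2)) ≤
      ENNReal.ofReal (q / (k - σ)) * ∫⁻ z, ‖w z‖ₑ ^ (q - 1) * ‖fderiv ℝ w z‖ₑ *
        ENNReal.ofReal (ε + cylNorm k z ^ 2) ^ ((1 - σ) / 2) := by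
  set g : EuclideanSpace ℝ (Fin n) → ℝ := fun z => ‖w z‖ ^ q with hg
  have hgC : ContDiff ℝ 1 g := hw.norm_rpow hq
  have hgc : HasCompactSupport g := hwc.comp_left (g := fun t : ℝ => ‖t‖ ^ q)
    (by simp [Real.zero_rpow (by linarith : q ≠ 0)])
  have hg0 : ∀ z, 0 ≤ g z := fun z => Real.rpow_nonneg (norm_nonneg _) _
  have hH := hardy_regularized hkn hε hσ hgC hgc hg0
  have hwt : ∀ (a : ℝ) (z : EuclideanSpace ℝ (Fin n)),
      ENNReal.ofReal (ε + cylNorm k z ^ 2) ^ a = ENNReal.ofReal ((ε + cylNorm k z ^ 2) ^ a) :=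
    fun a z => ENNReal.ofReal_rpow_of_pos (regularized_pos k hε z)
  have hw0 : ∀ (a : ℝ) (z : EuclideanSpace ℝ (Fin n)), 0 ≤ (ε + cylNorm k z ^ 2) ^ a :=
    fun a z => Real.rpow_nonneg (regularized_pos k hε z).le _
  have hI1 : Integrable (fun z => g z * (ε + cylNorm k z ^ 2) ^ (-(σ / 2))) :=
    (hgC.continuous.mul
      (contDiff_regularized_rpow k hε _).continuous).integrable_of_hasCompactSupport hgc.mul_right
  have hI2 : Integrable (fun z => ‖fderiv ℝ g z‖ * (ε + cylNorm k z ^ 2) ^ ((1 - σ) / 2)) :=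
    ((hgC.continuous_fderiv one_ne_zero).norm.mul
      (contDiff_regularized_rpow k hε _).continuous).integrable_of_hasCompactSupport
      (hgc.fderiv ℝ).norm.mul_right
  have hL : ∫⁻ z, ‖w z‖ₑ ^ q * ENNReal.ofReal (ε + cylNorm k z ^ 2) ^ (-(σ / 2)) =
      ENNReal.ofReal (∫ z, g z * (ε + cylNorm k z ^ 2) ^ (-(σ / 2))) := by
    rw [ofReal_integral_eq_lintegral_ofReal hI1
      (ae_of_all _ fun z => mul_nonneg (hg0 z) (hw0 _ z))]
    refine lintegral_congr fun z => ?_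
    rw [hwt, ENNReal.ofReal_mul (hg0 z), hg,
      ← ENNReal.ofReal_rpow_of_nonneg (norm_nonneg _) (by linarith), ofReal_norm]
  refine ⟨by rw [hL]; exact ENNReal.ofReal_ne_top, ?_⟩
  have hkσ : 0 < (k : ℝ) - σ := by linarith
  have hH' : ∫ z, g z * (ε + cylNorm k z ^ 2) ^ (-(σ / 2)) ≤
      1 / (k - σ) * ∫ z, ‖fderiv ℝ g z‖ * (ε + cylNorm k z ^ 2) ^ ((1 - σ) / 2) := by
    rw [div_mul_eq_mul_div, one_mul, le_div_iff₀ hkσ, mul_comm]; exact hH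
  rw [hL]
  refine (ENNReal.ofReal_le_ofReal hH').trans ?_
  rw [ENNReal.ofReal_mul (by positivity), ofReal_integral_eq_lintegral_ofReal hI2
      (ae_of_all _ fun z => mul_nonneg (norm_nonneg _) (hw0 _ z)),
    show q / ((k : ℝ) - σ) = 1 / (k - σ) * q by ring, ENNReal.ofReal_mul (by positivity), mul_assoc,
    ← lintegral_const_mul' (ENNReal.ofReal q) _ ENNReal.ofReal_ne_top]
  gcongr with z
  rw [ENNReal.ofReal_mul (norm_nonneg _), hwt, ← mul_assoc, ofReal_norm]
  gcongr
  have h := norm_fderiv_norm_rpow_le (hw.differentiable one_ne_zero) (x := z) hq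
  have h' := ENNReal.ofReal_le_ofReal h
  rw [ofReal_norm, ENNReal.ofReal_mul (by positivity), ENNReal.ofReal_mul (by linarith),
    ← ENNReal.ofReal_rpow_of_nonneg (norm_nonneg _) (by linarith), ofReal_norm, ofReal_norm,
    mul_assoc] at h'
  exact h'

/-- Hardy–Sobolev inequality for the regularized weight and `1 ≤ τ < min p k`: the Hardy
inequality for `|w|^q` and Hölder's inequality bound the left side by a power of itself which is
smaller than one. -/
lemma hardySobolev_regularized {n k : ℕ} (hkn : k ≤ n) {ε τ p : ℝ} (hε : 0 < ε) (hτ1 : 1 ≤ τ)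
    (hτp : τ < p) (hτk : τ < k) (hpn : p < n)
    {w : EuclideanSpace ℝ (Fin n) → ℝ} (hw : ContDiff ℝ 1 w) (hwc : HasCompactSupport w) :
    ∫⁻ z, ‖w z‖ₑ ^ hardySobolevConj n p τ * ENNReal.ofReal (ε + cylNorm k z ^ 2) ^ (-(τ / 2)) ≤
      (ENNReal.ofReal (hardySobolevConj n p τ / (k - τ)) *
        ((∫⁻ z, ‖w z‖ₑ ^ sobolevConj n p) ^ (1 / τ - 1 / p) *
          (∫⁻ z, ‖fderiv ℝ w z‖ₑ ^ p) ^ (1 / p))) ^ τ := by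
  have hτ0 : 0 < τ := by linarith
  have hp0 : 0 < p := by linarith
  have hnp : 0 < (n : ℝ) - p := by linarith
  set q := hardySobolevConj n p τ with hq
  have hqp : p < q := by
    rw [hq, hardySobolevConj, lt_div_iff₀ hnp]
    exact mul_lt_mul_of_pos_left (by linarith) hp0
  have hqτ : sobolevConj n p * (1 / τ - 1 / p) = q / τ - 1 := by
    rw [hq, hardySobolevConj, sobolevConj]
    field_simp
    ring
  have hd : 0 ≤ 1 / τ - 1 / p := by
    rw [sub_nonneg]; exact one_div_le_one_div_of_le hτ0 hτp.le
  have hqτ1 : 0 ≤ q / τ - 1 := by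
    rw [sub_nonneg, le_div_iff₀ hτ0]; linarith
  have hθ : 0 ≤ 1 - 1 / τ := by
    rw [sub_nonneg, div_le_one hτ0]; exact hτ1
  have hθ1 : 1 - 1 / τ < 1 := sub_lt_self _ (by positivity)
  obtain ⟨hfin, hle⟩ := hardy_regularized_rpow hkn hε hτ0.le hτk (by linarith : 1 < q) hw hwc
  set E : EuclideanSpace ℝ (Fin n) → ENNReal := fun z => ENNReal.ofReal (ε + cylNorm k z ^ 2)
    with hE
  set I := ∫⁻ z, ‖w z‖ₑ ^ q * E z ^ (-(τ / 2)) with hI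
  have hEm : Measurable E :=
    (measurable_const.add ((continuous_cylNorm k).measurable.pow_const 2)).ennreal_ofReal
  have hwm : Measurable fun z => ‖w z‖ₑ := hw.continuous.enorm.measurable
  have hdm : Measurable fun z => ‖fderiv ℝ w z‖ₑ :=
    (hw.continuous_fderiv one_ne_zero).enorm.measurable
  have hpt : ∀ z, ‖w z‖ₑ ^ (q - 1) * ‖fderiv ℝ w z‖ₑ * E z ^ ((1 - τ) / 2) =
      (‖w z‖ₑ ^ q * E z ^ (-(τ / 2))) ^ (1 - 1 / τ) *
        (‖w z‖ₑ ^ sobolevConj n p) ^ (1 / τ - 1 / p) * (‖fderiv ℝ w z‖ₑ ^ p) ^ (1 / p) := by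
    intro z
    rw [ENNReal.mul_rpow_of_nonneg _ _ hθ, ← ENNReal.rpow_mul, ← ENNReal.rpow_mul,
      ← ENNReal.rpow_mul, ← ENNReal.rpow_mul, hqτ, mul_one_div_cancel hp0.ne', ENNReal.rpow_one]
    have h1 : q - 1 = q * (1 - 1 / τ) + (q / τ - 1) := by field_simp; ring
    have h2 : (1 - τ) / 2 = -(τ / 2) * (1 - 1 / τ) := by field_simp; ring
    rw [h1, ENNReal.rpow_add_of_nonneg _ _ (mul_nonneg (by linarith) hθ) hqτ1, h2]
    ring
  have hle' : I ≤ ENNReal.ofReal (q / (k - τ)) *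
      ∫⁻ z, ‖w z‖ₑ ^ (q - 1) * ‖fderiv ℝ w z‖ₑ * E z ^ ((1 - τ) / 2) := hle
  rw [lintegral_congr hpt] at hle'
  have hhol := lintegral_rpow_mul_rpow_mul_rpow_le (μ := volume)
    (F := fun z => ‖w z‖ₑ ^ q * E z ^ (-(τ / 2)))
    (G := fun z => ‖w z‖ₑ ^ sobolevConj n p) (H := fun z => ‖fderiv ℝ w z‖ₑ ^ p)
    ((hwm.pow_const q).mul (hEm.pow_const _)).aemeasurable
    (hwm.pow_const _).aemeasurable (hdm.pow_const p).aemeasurable hθ hd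
    (by positivity : 0 ≤ 1 / p) (by ring)
  have h3 : I ≤ (ENNReal.ofReal (q / (k - τ)) *
      ((∫⁻ z, ‖w z‖ₑ ^ sobolevConj n p) ^ (1 / τ - 1 / p) *
          (∫⁻ z, ‖fderiv ℝ w z‖ₑ ^ p) ^ (1 / p))) * I ^ (1 - 1 / τ) := by
    refine hle'.trans ((mul_le_mul_right hhol _).trans (le_of_eq ?_))
    ring
  have h4 := rpow_one_sub_le_of_le_mul_rpow hfin hθ1 h3
  rw [sub_sub_cancel] at h4
  calc I = (I ^ (1 / τ)) ^ τ := by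
        rw [← ENNReal.rpow_mul, one_div_mul_cancel hτ0.ne', ENNReal.rpow_one]
    _ ≤ _ := ENNReal.rpow_le_rpow h4 hτ0.le

/-- Hardy–Sobolev inequality with weight `|x|^{-τ}`, `1 ≤ τ < min p k`. -/
lemma hardySobolev_of_one_le {n k : ℕ} (hkn : k ≤ n) {τ p : ℝ} (hτ1 : 1 ≤ τ)
    (hτp : τ < p) (hτk : τ < k) (hpn : p < n) :
    ∃ C : ENNReal, C ≠ ⊤ ∧ ∀ w : EuclideanSpace ℝ (Fin n) → ℝ, ContDiff ℝ 1 w →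
      HasCompactSupport w →
      ∫⁻ z, ‖w z‖ₑ ^ hardySobolevConj n p τ * ENNReal.ofReal (cylNorm k z ^ (-τ)) ≤
        C * eLpNorm (fderiv ℝ w) (ENNReal.ofReal p) volume ^ hardySobolevConj n p τ := by
  have hτ0 : 0 < τ := by linarith
  have hp0 : 0 < p := by linarith
  have hnp : 0 < (n : ℝ) - p := by linarith
  obtain ⟨S, hS, hSob⟩ := sobolev_fderiv (n := n) (by linarith : 1 < p) hpn
  set q := hardySobolevConj n p τ with hq
  have hqp : p < q := by
    rw [hq, hardySobolevConj, lt_div_iff₀ hnp]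
    exact mul_lt_mul_of_pos_left (by linarith) hp0
  have hps : 0 < sobolevConj n p := div_pos (mul_pos (by linarith) hp0) hnp
  have hqτ : sobolevConj n p * (1 / τ - 1 / p) = q / τ - 1 := by
    rw [hq, hardySobolevConj, sobolevConj]
    field_simp
    ring
  have hd : 0 ≤ 1 / τ - 1 / p := by
    rw [sub_nonneg]; exact one_div_le_one_div_of_le hτ0 hτp.le
  have hqτ1 : 0 ≤ q / τ - 1 := by
    rw [sub_nonneg, le_div_iff₀ hτ0]; linarith
  refine ⟨(ENNReal.ofReal (q / (k - τ)) * S ^ (q / τ - 1)) ^ τ,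
    ENNReal.rpow_ne_top_of_nonneg hτ0.le (ENNReal.mul_ne_top ENNReal.ofReal_ne_top
      (ENNReal.rpow_ne_top_of_nonneg hqτ1 hS)), fun w hw hwc => ?_⟩
  set Y := eLpNorm (fderiv ℝ w) (ENNReal.ofReal p) volume with hY
  have hreg : ∀ m : ℕ, ∫⁻ z, ‖w z‖ₑ ^ q *
      ENNReal.ofReal (1 / ((m : ℝ) + 1) + cylNorm k z ^ 2) ^ (-(τ / 2)) ≤
      (ENNReal.ofReal (q / (k - τ)) * S ^ (q / τ - 1)) ^ τ * Y ^ q := by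
    intro m
    refine (hardySobolev_regularized hkn (by positivity) hτ1 hτp hτk hpn hw hwc).trans ?_
    have h1 : (∫⁻ z, ‖w z‖ₑ ^ sobolevConj n p) ^ (1 / τ - 1 / p) ≤ (S * Y) ^ (q / τ - 1) := by
      rw [← eLpNorm_ofReal_rpow w hps, ← ENNReal.rpow_mul, hqτ]
      exact ENNReal.rpow_le_rpow (hSob w hw hwc) hqτ1
    rw [← eLpNorm_ofReal_eq _ hp0, ← hY]
    have h2 : Y ^ q = (Y ^ (q / τ - 1) * Y) ^ τ := by
      nth_rewrite 3 [← ENNReal.rpow_one Y]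
      rw [← ENNReal.rpow_add_of_nonneg _ _ hqτ1 zero_le_one, ← ENNReal.rpow_mul]
      congr 1
      field_simp
      ring
    rw [h2, ← ENNReal.mul_rpow_of_nonneg _ _ hτ0.le]
    refine ENNReal.rpow_le_rpow ?_ hτ0.le
    calc _ ≤ ENNReal.ofReal (q / (k - τ)) * ((S * Y) ^ (q / τ - 1) * Y) := by gcongr
      _ = _ := by rw [ENNReal.mul_rpow_of_nonneg _ _ hqτ1]; ring
  have hwm : Measurable fun z => ‖w z‖ₑ := hw.continuous.enorm.measurable
  have hEm : ∀ m : ℕ, Measurable fun z : EuclideanSpace ℝ (Fin n) =>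
      ENNReal.ofReal (1 / ((m : ℝ) + 1) + cylNorm k z ^ 2) := fun m =>
    (measurable_const.add ((continuous_cylNorm k).measurable.pow_const 2)).ennreal_ofReal
  calc ∫⁻ z, ‖w z‖ₑ ^ q * ENNReal.ofReal (cylNorm k z ^ (-τ))
      ≤ ∫⁻ z, liminf (fun m : ℕ => ‖w z‖ₑ ^ q *
        ENNReal.ofReal (1 / ((m : ℝ) + 1) + cylNorm k z ^ 2) ^ (-(τ / 2))) atTop := by
        refine lintegral_mono fun z => ?_
        rcases (cylNorm_nonneg k z).eq_or_lt with h0 | h0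
        · -- At `x = 0` the real power `0 ^ (-τ)` is `0`, so nothing has to be shown.
          simp [← h0, Real.zero_rpow (by linarith : -τ ≠ 0)]
        · have ht : Tendsto (fun m : ℕ => ENNReal.ofReal (1 / ((m : ℝ) + 1) + cylNorm k z ^ 2)
              ^ (-(τ / 2))) atTop (𝓝 (ENNReal.ofReal (0 + cylNorm k z ^ 2) ^ (-(τ / 2)))) :=
            ((ENNReal.continuous_rpow_const).tendsto _).comp
              ((ENNReal.continuous_ofReal.tendsto _).comp
                (tendsto_one_div_add_atTop_nhds_zero_nat.add_const _))
          have h2 : ENNReal.ofReal (0 + cylNorm k z ^ 2) ^ (-(τ / 2)) =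
              ENNReal.ofReal (cylNorm k z ^ (-τ)) := by
            rw [zero_add, ENNReal.ofReal_rpow_of_pos (by positivity), ← Real.rpow_natCast,
              ← Real.rpow_mul h0.le]
            congr 2; push_cast; ring
          rw [h2] at ht
          exact (ENNReal.Tendsto.const_mul ht (Or.inr (ENNReal.rpow_ne_top_of_nonneg
            (by linarith) enorm_ne_top))).liminf_eq.ge
    _ ≤ liminf (fun m : ℕ => ∫⁻ z, ‖w z‖ₑ ^ q *
        ENNReal.ofReal (1 / ((m : ℝ) + 1) + cylNorm k z ^ 2) ^ (-(τ / 2))) atTop :=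
        lintegral_liminf_le fun m => (hwm.pow_const q).mul ((hEm m).pow_const _)
    _ ≤ _ := liminf_le_of_le (by isBoundedDefault) fun b hb => by
        obtain ⟨m, hm⟩ := hb.exists
        exact hm.trans (hreg m)

/-- Hardy–Sobolev inequality with weight `|x|^{-σ}`, `0 ≤ σ < min p k`. The range `σ < 1` is
reached by interpolating between `σ = 0` (Sobolev) and `σ = 1`, for which `2 ≤ k` is used. -/
lemma hardySobolev_fderiv {n k : ℕ} (hk2 : 2 ≤ k) (hkn : k ≤ n) {σ p : ℝ} (hp1 : 1 < p)
    (hσ : 0 ≤ σ) (hσp : σ < p) (hσk : σ < k) (hpn : p < n) :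
    ∃ C : ENNReal, C ≠ ⊤ ∧ ∀ w : EuclideanSpace ℝ (Fin n) → ℝ, ContDiff ℝ 1 w →
      HasCompactSupport w →
      eLpNorm (fun z => cylNorm k z ^ (-(σ / hardySobolevConj n p σ)) * w z)
          (ENNReal.ofReal (hardySobolevConj n p σ)) volume ≤
        C * eLpNorm (fderiv ℝ w) (ENNReal.ofReal p) volume := by
  have hp0 : 0 < p := by linarith
  have hnp : 0 < (n : ℝ) - p := by linarith
  have hk : (2 : ℝ) ≤ k := by exact_mod_cast hk2
  set τ := max σ 1 with hτ
  have hτ1 : 1 ≤ τ := le_max_right _ _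
  have hτ0 : 0 < τ := by linarith
  have hστ : σ ≤ τ := le_max_left _ _
  have hτp : τ < p := max_lt hσp hp1
  have hτk : τ < k := max_lt hσk (by linarith)
  obtain ⟨S, hS, hSob⟩ := sobolev_fderiv (n := n) hp1 hpn
  obtain ⟨C, hC, hHS⟩ := hardySobolev_of_one_le hkn hτ1 hτp hτk hpn
  set q := hardySobolevConj n p σ with hq
  set qτ := hardySobolevConj n p τ with hqτ
  set P := sobolevConj n p with hP
  have hqτ0 : 0 < qτ := div_pos (mul_pos hp0 (by linarith)) hnp
  have hq0 : 0 < q := div_pos (mul_pos hp0 (by linarith)) hnp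
  have hP0 : 0 < P := div_pos (mul_pos (by linarith) hp0) hnp
  set θ := σ / τ with hθ
  have hθ0 : 0 ≤ θ := div_nonneg hσ hτ0.le
  have hθ1 : 0 ≤ 1 - θ := by rw [sub_nonneg, hθ, div_le_one hτ0]; exact hστ
  have hqe : q = qτ * θ + P * (1 - θ) := by
    rw [hq, hqτ, hP, hθ, hardySobolevConj, hardySobolevConj, sobolevConj]
    field_simp
    ring
  refine ⟨(C ^ θ * (S ^ P) ^ (1 - θ)) ^ (1 / q), ENNReal.rpow_ne_top_of_nonneg (by positivity)
    (ENNReal.mul_ne_top (ENNReal.rpow_ne_top_of_nonneg hθ0 hC) (ENNReal.rpow_ne_top_of_nonneg hθ1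
      (ENNReal.rpow_ne_top_of_nonneg hP0.le hS))), fun w hw hwc => ?_⟩
  set Y := eLpNorm (fderiv ℝ w) (ENNReal.ofReal p) volume with hY
  have hwm : Measurable fun z => ‖w z‖ₑ := hw.continuous.enorm.measurable
  have hwtm : Measurable fun z : EuclideanSpace ℝ (Fin n) =>
      ENNReal.ofReal (cylNorm k z ^ (-τ)) :=
    ((continuous_cylNorm k).measurable.pow_const _).ennreal_ofReal
  have hpt : ∀ z, ‖cylNorm k z ^ (-(σ / q)) * w z‖ₑ ^ q =
      (‖w z‖ₑ ^ qτ * ENNReal.ofReal (cylNorm k z ^ (-τ))) ^ θ * (‖w z‖ₑ ^ P) ^ (1 - θ) := by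
    intro z
    have hc := cylNorm_nonneg k z
    have e1 : ‖cylNorm k z ^ (-(σ / q))‖ₑ ^ q = ENNReal.ofReal (cylNorm k z ^ (-τ)) ^ θ := by
      rw [Real.enorm_of_nonneg (Real.rpow_nonneg hc _),
        ENNReal.ofReal_rpow_of_nonneg (Real.rpow_nonneg hc _) hq0.le,
        ENNReal.ofReal_rpow_of_nonneg (Real.rpow_nonneg hc _) hθ0,
        ← Real.rpow_mul hc, ← Real.rpow_mul hc]
      congr 2
      rw [hθ]; field_simp
    rw [enorm_mul, ENNReal.mul_rpow_of_nonneg _ _ hq0.le, e1, ENNReal.mul_rpow_of_nonneg _ _ hθ0,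
      ← ENNReal.rpow_mul, ← ENNReal.rpow_mul]
    nth_rewrite 1 [hqe]
    rw [ENNReal.rpow_add_of_nonneg _ _ (by positivity) (by positivity)]
    ring
  have hbound : ∫⁻ z, ‖cylNorm k z ^ (-(σ / q)) * w z‖ₑ ^ q ≤
      (C ^ θ * (S ^ P) ^ (1 - θ)) * Y ^ q := by
    simp_rw [hpt]
    have hhol := ENNReal.lintegral_mul_norm_pow_le (μ := volume)
      (((hwm.pow_const qτ).mul hwtm).aemeasurable) ((hwm.pow_const P).aemeasurable) hθ0 hθ1
      (by ring)
    refine hhol.trans ?_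
    have h1 : ∫⁻ z, ‖w z‖ₑ ^ P ≤ (S * Y) ^ P := by
      rw [← eLpNorm_ofReal_rpow w hP0]
      exact ENNReal.rpow_le_rpow (hSob w hw hwc) hP0.le
    calc _ ≤ (C * Y ^ qτ) ^ θ * ((S * Y) ^ P) ^ (1 - θ) :=
          mul_le_mul' (ENNReal.rpow_le_rpow (hHS w hw hwc) hθ0) (ENNReal.rpow_le_rpow h1 hθ1)
      _ = _ := by
          rw [hqe, ENNReal.rpow_add_of_nonneg _ _ (by positivity) (by positivity),
            ENNReal.mul_rpow_of_nonneg _ _ hθ0, ENNReal.mul_rpow_of_nonneg _ _ hP0.le,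
            ENNReal.mul_rpow_of_nonneg _ _ hθ1, ENNReal.rpow_mul Y, ENNReal.rpow_mul Y]
          ring
  rw [eLpNorm_ofReal_eq _ hq0]
  refine (ENNReal.rpow_le_rpow hbound (by positivity)).trans (le_of_eq ?_)
  rw [ENNReal.mul_rpow_of_nonneg _ _ (by positivity), ← ENNReal.rpow_mul Y,
    mul_one_div_cancel hq0.ne', ENNReal.rpow_one]

/-! ### Limits of compactly supported functions with convergent gradients -/

/-- The functions `ψ j ∈ C¹_c(Ω)` converge to `v` almost everywhere in `Ω`, and their gradients
converge to `H` in `L^p(Ω)`. For `p < n` this exhibits `v` as an element of `D^{1,p}(Ω)` with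
gradient `H`. -/
structure IsGradLimit {n : ℕ} (Ω : Set (EuclideanSpace ℝ (Fin n))) (p : ℝ)
    (v : EuclideanSpace ℝ (Fin n) → ℝ) (H : EuclideanSpace ℝ (Fin n) → EuclideanSpace ℝ (Fin n))
    (ψ : ℕ → EuclideanSpace ℝ (Fin n) → ℝ) : Prop where
  contDiff : ∀ j, ContDiff ℝ 1 (ψ j)
  compact : ∀ j, HasCompactSupport (ψ j)
  supp : ∀ j, tsupport (ψ j) ⊆ Ω
  ae_tendsto : ∀ᵐ z ∂(volume.restrict Ω), Tendsto (fun j => ψ j z) atTop (𝓝 (v z))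
  aesm : AEStronglyMeasurable H (volume.restrict Ω)
  grad_tendsto : Tendsto (fun j => eLpNorm (fun z => gradient (ψ j) z - H z) (ENNReal.ofReal p)
    (volume.restrict Ω)) atTop (𝓝 0)

lemma norm_gradient {n : ℕ} (f : EuclideanSpace ℝ (Fin n) → ℝ) (z : EuclideanSpace ℝ (Fin n)) :
    ‖gradient f z‖ = ‖fderiv ℝ f z‖ := by
  rw [gradient, LinearIsometryEquiv.norm_map]

lemma continuous_gradient {n : ℕ} {f : EuclideanSpace ℝ (Fin n) → ℝ} (hf : ContDiff ℝ 1 f) :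
    Continuous (gradient f) :=
  (InnerProductSpace.toDual ℝ _).symm.continuous.comp (hf.continuous_fderiv one_ne_zero)

lemma gradient_sub_apply {n : ℕ} {f g : EuclideanSpace ℝ (Fin n) → ℝ} (hf : ContDiff ℝ 1 f)
    (hg : ContDiff ℝ 1 g) (z : EuclideanSpace ℝ (Fin n)) :
    gradient (fun z => f z - g z) z = gradient f z - gradient g z := by
  rw [gradient, fderiv_fun_sub (hf.differentiable one_ne_zero z) (hg.differentiable one_ne_zero z),
    map_sub]
  rfl

lemma gradient_comp_apply {n : ℕ} {F : ℝ → ℝ} {f : EuclideanSpace ℝ (Fin n) → ℝ}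
    (hF : ContDiff ℝ 1 F) (hf : ContDiff ℝ 1 f) (z : EuclideanSpace ℝ (Fin n)) :
    gradient (fun z => F (f z)) z = deriv F (f z) • gradient f z := by
  have h : HasFDerivAt (fun z => F (f z)) (deriv F (f z) • fderiv ℝ f z) z :=
    (hF.differentiable one_ne_zero (f z)).hasDerivAt.comp_hasFDerivAt z
      (hf.differentiable one_ne_zero z).hasFDerivAt
  rw [gradient, h.fderiv, gradient]
  simp

lemma eLpNorm_fderiv_eq_gradient {n : ℕ} {Ω : Set (EuclideanSpace ℝ (Fin n))}
    {f : EuclideanSpace ℝ (Fin n) → ℝ} (hs : tsupport f ⊆ Ω) (p : ENNReal) :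
    eLpNorm (fderiv ℝ f) p volume = eLpNorm (gradient f) p (volume.restrict Ω) := by
  have h1 : Function.support (fun z => ‖gradient f z‖) ⊆ Ω := fun z hz =>
    hs (support_fderiv_subset ℝ fun h0 => hz (by simp [norm_gradient, h0]))
  have h2 : eLpNorm (fun z => ‖gradient f z‖) p (volume.restrict Ω) =
      eLpNorm (fun z => ‖gradient f z‖) p volume := eLpNorm_restrict_eq_of_support_subset h1
  rw [eLpNorm_norm] at h2
  rw [h2]
  simp_rw [norm_gradient]
  exact (eLpNorm_norm _).symm

lemma IsGradLimit.const_sub {n : ℕ} {Ω : Set (EuclideanSpace ℝ (Fin n))} {p : ℝ}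
    {v : EuclideanSpace ℝ (Fin n) → ℝ} {H : EuclideanSpace ℝ (Fin n) → EuclideanSpace ℝ (Fin n)}
    {ψ : ℕ → EuclideanSpace ℝ (Fin n) → ℝ} (h : IsGradLimit Ω p v H ψ) (j : ℕ) :
    IsGradLimit Ω p (fun z => ψ j z - v z) (fun z => gradient (ψ j) z - H z)
      (fun i z => ψ j z - ψ i z) where
  contDiff i := (h.contDiff j).sub (h.contDiff i)
  compact i := (h.compact j).sub (h.compact i)
  supp i := (tsupport_sub (ψ j) (ψ i)).trans (Set.union_subset (h.supp j) (h.supp i))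
  ae_tendsto := h.ae_tendsto.mono fun z hz => hz.const_sub _
  aesm := (continuous_gradient (h.contDiff j)).aestronglyMeasurable.sub h.aesm
  grad_tendsto := by
    refine h.grad_tendsto.congr fun i => ?_
    rw [← eLpNorm_neg]
    refine eLpNorm_congr_ae (ae_of_all _ fun z => ?_)
    simp only [Pi.neg_apply, gradient_sub_apply (h.contDiff j) (h.contDiff i)]
    abel

/-- An inequality `‖ω w‖_q ≤ C ‖∇w‖_p` on `C¹_c` passes to limits, by Fatou's lemma. -/
lemma IsGradLimit.eLpNorm_mul_le {n : ℕ} {Ω : Set (EuclideanSpace ℝ (Fin n))} {p : ℝ}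
    (hp : 1 ≤ p) {q C : ENNReal} (hC : C ≠ ⊤) {ω : EuclideanSpace ℝ (Fin n) → ℝ}
    (hω : Measurable ω)
    (hineq : ∀ w : EuclideanSpace ℝ (Fin n) → ℝ, ContDiff ℝ 1 w → HasCompactSupport w →
      eLpNorm (fun z => ω z * w z) q volume ≤ C * eLpNorm (fderiv ℝ w) (ENNReal.ofReal p) volume)
    {v : EuclideanSpace ℝ (Fin n) → ℝ} {H : EuclideanSpace ℝ (Fin n) → EuclideanSpace ℝ (Fin n)}
    {ψ : ℕ → EuclideanSpace ℝ (Fin n) → ℝ} (h : IsGradLimit Ω p v H ψ) :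
    eLpNorm (fun z => ω z * v z) q (volume.restrict Ω) ≤
      C * eLpNorm H (ENNReal.ofReal p) (volume.restrict Ω) := by
  have hp' : 1 ≤ ENNReal.ofReal p := by simpa using ENNReal.ofReal_le_ofReal hp
  have hlim : Tendsto (fun j => C * (eLpNorm (fun z => gradient (ψ j) z - H z) (ENNReal.ofReal p)
      (volume.restrict Ω) + eLpNorm H (ENNReal.ofReal p) (volume.restrict Ω))) atTop
      (𝓝 (C * eLpNorm H (ENNReal.ofReal p) (volume.restrict Ω))) := by
    have := ENNReal.Tendsto.const_mul (a := C) (h.grad_tendsto.add_const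
      (eLpNorm H (ENNReal.ofReal p) (volume.restrict Ω))) (Or.inr hC)
    rwa [zero_add] at this
  rw [← hlim.liminf_eq]
  refine (Lp.eLpNorm_lim_le_liminf_eLpNorm (f := fun j z => ω z * ψ j z)
    (fun j => (hω.aestronglyMeasurable.mul (h.contDiff j).continuous.aestronglyMeasurable)) _
    (h.ae_tendsto.mono fun z hz => hz.const_mul _)).trans ?_
  refine liminf_le_liminf (Eventually.of_forall fun j => ?_)
  calc eLpNorm (fun z => ω z * ψ j z) q (volume.restrict Ω)
      ≤ eLpNorm (fun z => ω z * ψ j z) q volume := eLpNorm_restrict_le _ _ _ _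
    _ ≤ C * eLpNorm (fderiv ℝ (ψ j)) (ENNReal.ofReal p) volume :=
        hineq _ (h.contDiff j) (h.compact j)
    _ ≤ _ := by
        rw [eLpNorm_fderiv_eq_gradient (h.supp j)]
        refine mul_le_mul_right ?_ _
        have := eLpNorm_add_le (μ := volume.restrict Ω) (p := ENNReal.ofReal p)
          (f := fun z => gradient (ψ j) z - H z) (g := H)
          ((continuous_gradient (h.contDiff j)).aestronglyMeasurable.sub h.aesm) h.aesm hp'
        refine le_trans (le_of_eq ?_) this
        congr 1
        ext1 z
        simp

/-- Convergence counterpart of `IsGradLimit.eLpNorm_mul_le`. -/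
lemma IsGradLimit.tendsto_eLpNorm_mul_sub {n : ℕ} {Ω : Set (EuclideanSpace ℝ (Fin n))}
    {p : ℝ} (hp : 1 ≤ p) {q C : ENNReal} (hC : C ≠ ⊤)
    {ω : EuclideanSpace ℝ (Fin n) → ℝ} (hω : Measurable ω)
    (hineq : ∀ w : EuclideanSpace ℝ (Fin n) → ℝ, ContDiff ℝ 1 w → HasCompactSupport w →
      eLpNorm (fun z => ω z * w z) q volume ≤ C * eLpNorm (fderiv ℝ w) (ENNReal.ofReal p) volume)
    {v : EuclideanSpace ℝ (Fin n) → ℝ} {H : EuclideanSpace ℝ (Fin n) → EuclideanSpace ℝ (Fin n)}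
    {ψ : ℕ → EuclideanSpace ℝ (Fin n) → ℝ} (h : IsGradLimit Ω p v H ψ) :
    Tendsto (fun j => eLpNorm (fun z => ω z * (ψ j z - v z)) q (volume.restrict Ω)) atTop
      (𝓝 0) := by
  have hlim := ENNReal.Tendsto.const_mul (a := C) h.grad_tendsto (Or.inr hC)
  rw [mul_zero] at hlim
  exact tendsto_of_tendsto_of_tendsto_of_le_of_le tendsto_const_nhds hlim (fun _ => zero_le)
    fun j => (h.const_sub j).eLpNorm_mul_le hp hC hω hineq

/-- Chain rule for limits: `F ∘ v` is the limit of `F ∘ ψ j`, with gradient `F'(v) H`. -/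
lemma IsGradLimit.comp {n : ℕ} {Ω : Set (EuclideanSpace ℝ (Fin n))}
    {p : ℝ} (hp : 1 ≤ p) {v : EuclideanSpace ℝ (Fin n) → ℝ}
    {H : EuclideanSpace ℝ (Fin n) → EuclideanSpace ℝ (Fin n)}
    {ψ : ℕ → EuclideanSpace ℝ (Fin n) → ℝ} (h : IsGradLimit Ω p v H ψ)
    (hH : MemLp H (ENNReal.ofReal p) (volume.restrict Ω))
    {F : ℝ → ℝ} (hF : ContDiff ℝ 1 F) (hF0 : F 0 = 0) {B : ℝ} (hB : ∀ t, |deriv F t| ≤ B) :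
    IsGradLimit Ω p (fun z => F (v z)) (fun z => deriv F (v z) • H z) (fun j z => F (ψ j z)) := by
  have hp' : 1 ≤ ENNReal.ofReal p := by simpa using ENNReal.ofReal_le_ofReal hp
  have hp0 : 0 < p := by linarith
  have hFc : Continuous (deriv F) := hF.continuous_deriv_one
  have hB0 : 0 ≤ B := (abs_nonneg _).trans (hB 0)
  have hvm : AEStronglyMeasurable v (volume.restrict Ω) :=
    aestronglyMeasurable_of_tendsto_ae atTop
      (fun j => (h.contDiff j).continuous.aestronglyMeasurable) h.ae_tendsto
  have hFv : AEStronglyMeasurable (fun z => deriv F (v z)) (volume.restrict Ω) :=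
    hFc.comp_aestronglyMeasurable hvm
  have hFψ : ∀ j, AEStronglyMeasurable (fun z => deriv F (ψ j z)) (volume.restrict Ω) :=
    fun j => (hFc.comp (h.contDiff j).continuous).aestronglyMeasurable
  have hgψ : ∀ j, AEStronglyMeasurable (gradient (ψ j)) (volume.restrict Ω) :=
    fun j => (continuous_gradient (h.contDiff j)).aestronglyMeasurable
  refine ⟨fun j => hF.comp (h.contDiff j), fun j => (h.compact j).comp_left hF0, fun j => ?_,
    h.ae_tendsto.mono fun z hz => (hF.continuous.tendsto _).comp hz, hFv.smul h.aesm, ?_⟩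
  · exact (tsupport_comp_subset (g := F) hF0 (ψ j)).trans (h.supp j)
  have hdct : Tendsto (fun j => ∫⁻ z in Ω, ‖(deriv F (ψ j z) - deriv F (v z)) • H z‖ₑ ^ p) atTop
      (𝓝 (∫⁻ _ in Ω, 0)) := by
    refine tendsto_lintegral_of_dominated_convergence'
      (fun z => (ENNReal.ofReal (2 * B) * ‖H z‖ₑ) ^ p)
      (fun j => (((hFψ j).sub hFv).smul h.aesm).enorm.pow_const p)
      (fun j => ae_of_all _ fun z => ?_) ?_ ?_
    · refine ENNReal.rpow_le_rpow ?_ hp0.le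
      rw [enorm_smul]
      refine mul_le_mul' ?_ le_rfl
      rw [← ofReal_norm]
      refine ENNReal.ofReal_le_ofReal ?_
      rw [Real.norm_eq_abs]
      linarith [abs_sub (deriv F (ψ j z)) (deriv F (v z)), hB (ψ j z), hB (v z)]
    · simp_rw [ENNReal.mul_rpow_of_nonneg _ _ hp0.le]
      rw [lintegral_const_mul' _ _ (ENNReal.rpow_ne_top_of_nonneg hp0.le ENNReal.ofReal_ne_top),
        ← eLpNorm_ofReal_rpow H hp0]
      exact ENNReal.mul_ne_top (ENNReal.rpow_ne_top_of_nonneg hp0.le ENNReal.ofReal_ne_top)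
        (ENNReal.rpow_ne_top_of_nonneg hp0.le hH.eLpNorm_ne_top)
    · refine h.ae_tendsto.mono fun z hz => ?_
      have h1 : Tendsto (fun j => (deriv F (ψ j z) - deriv F (v z)) • H z) atTop (𝓝 0) := by
        have := (((hFc.tendsto _).comp hz).sub_const (deriv F (v z))).smul_const (H z)
        simpa using this
      have h2 := (ENNReal.continuous_rpow_const (y := p)).tendsto _ |>.comp (h1.enorm)
      simpa [ENNReal.zero_rpow_of_pos hp0, Function.comp_def] using h2
  have h2 : Tendsto (fun j => eLpNorm (fun z => (deriv F (ψ j z) - deriv F (v z)) • H z)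
      (ENNReal.ofReal p) (volume.restrict Ω)) atTop (𝓝 0) := by
    simp_rw [eLpNorm_ofReal_eq _ hp0]
    have := (ENNReal.continuous_rpow_const (y := 1 / p)).tendsto _ |>.comp hdct
    simpa [ENNReal.zero_rpow_of_pos (inv_pos.2 hp0), Function.comp_def] using this
  have h1 := ENNReal.Tendsto.const_mul (a := ENNReal.ofReal B) h.grad_tendsto
    (Or.inr ENNReal.ofReal_ne_top)
  have h3 := h1.add h2
  rw [mul_zero, zero_add] at h3
  refine tendsto_of_tendsto_of_tendsto_of_le_of_le tendsto_const_nhds h3 (fun _ => zero_le)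
    fun j => ?_
  -- Only `ψ j → v` is used for `F'(ψ j) → F'(v)`, hence the pairing of this factor with `H`.
  have e : (fun z => gradient (fun z => F (ψ j z)) z - deriv F (v z) • H z) =
      (fun z => deriv F (ψ j z) • (gradient (ψ j) z - H z)) +
        fun z => (deriv F (ψ j z) - deriv F (v z)) • H z := by
    ext1 z
    rw [gradient_comp_apply hF (h.contDiff j), Pi.add_apply, smul_sub, sub_smul]
    abel
  rw [e]
  refine (eLpNorm_add_le ((hFψ j).smul ((hgψ j).sub h.aesm))
    (((hFψ j).sub hFv).smul h.aesm) hp').trans (add_le_add ?_ le_rfl)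
  refine eLpNorm_le_mul_eLpNorm_of_ae_le_mul (ae_of_all _ fun z => ?_) _
  change ‖deriv F (ψ j z) • (gradient (ψ j) z - H z)‖ ≤ _
  rw [norm_smul]
  exact mul_le_mul_of_nonneg_right (hB _) (norm_nonneg _)

/-- Diagonal argument: `L¹_loc` convergence yields a subsequence converging almost everywhere. -/
lemma exists_strictMono_ae_tendsto {n : ℕ} {Ω : Set (EuclideanSpace ℝ (Fin n))} (hΩ : IsOpen Ω)
    {u : EuclideanSpace ℝ (Fin n) → ℝ} (hu : AEStronglyMeasurable u (volume.restrict Ω))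
    {φ : ℕ → EuclideanSpace ℝ (Fin n) → ℝ} (hφ : ∀ j, Continuous (φ j))
    (h : ∀ K : Set (EuclideanSpace ℝ (Fin n)), IsCompact K → K ⊆ Ω →
      Tendsto (fun j => eLpNorm (fun z => φ j z - u z) 1 (volume.restrict K)) atTop (𝓝 0)) :
    ∃ κ : ℕ → ℕ, StrictMono κ ∧
      ∀ᵐ z ∂(volume.restrict Ω), Tendsto (fun j => φ (κ j) z) atTop (𝓝 (u z)) := by
  obtain ⟨K, hK, hKΩ⟩ : IsSigmaCompact Ω := by
    have : LocallyCompactSpace Ω := hΩ.locallyCompactSpace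
    exact isSigmaCompact_iff_sigmaCompactSpace.2 inferInstance
  have hsub : ∀ m, K m ⊆ Ω := fun m => hKΩ ▸ Set.subset_iUnion K m
  obtain ⟨κ, hκ, hκ'⟩ := extraction_forall_of_eventually'
    (P := fun i j => ∀ m ∈ Finset.range (i + 1),
      eLpNorm (fun z => φ j z - u z) 1 (volume.restrict (K m)) ≤ (2⁻¹ : ENNReal) ^ i)
    (fun i => by
      have hev : ∀ᶠ j in atTop, ∀ m ∈ Finset.range (i + 1),
          eLpNorm (fun z => φ j z - u z) 1 (volume.restrict (K m)) ≤ (2⁻¹ : ENNReal) ^ i := by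
        rw [Filter.eventually_all_finset]
        exact fun m _ => (h (K m) (hK m) (hsub m)).eventually_le_const
          (ENNReal.pow_pos (by simp) i)
      obtain ⟨N, hN⟩ := eventually_atTop.1 hev
      exact ⟨N, hN⟩)
  refine ⟨κ, hκ, ?_⟩
  rw [← hKΩ, ae_restrict_iUnion_iff]
  intro m
  have hum : AEStronglyMeasurable u (volume.restrict (K m)) :=
    hu.mono_measure (Measure.restrict_mono (hsub m) le_rfl)
  have hmeas : ∀ i, AEMeasurable (fun z => ‖φ (κ (i + m)) z - u z‖ₑ) (volume.restrict (K m)) :=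
    fun i => ((hφ _).aestronglyMeasurable.sub hum).enorm
  have hsum : ∫⁻ z in K m, ∑' i, ‖φ (κ (i + m)) z - u z‖ₑ ≠ ⊤ := by
    rw [lintegral_tsum hmeas]
    refine ne_top_of_le_ne_top ?_ (ENNReal.tsum_le_tsum (g := fun i => (2⁻¹ : ENNReal) ^ i)
      fun i => ?_)
    · rw [ENNReal.tsum_geometric]; simp
    · rw [← eLpNorm_one_eq_lintegral_enorm]
      refine (hκ' (i + m) m (by simp)).trans ?_
      exact pow_le_pow_of_le_one zero_le (by simp) (by omega)
  filter_upwards [ae_lt_top' (AEMeasurable.tsum hmeas) hsum] with z hz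
  have h0 := ENNReal.tendsto_atTop_zero_of_tsum_ne_top hz.ne
  rw [← tendsto_add_atTop_iff_nat m]
  rw [tendsto_iff_edist_tendsto_0]
  simpa only [edist_eq_enorm_sub] using h0

lemma IsD1p.exists_isGradLimit {n : ℕ} {Ω : Set (EuclideanSpace ℝ (Fin n))} (hΩ : IsOpen Ω) {p : ℝ}
    {u : EuclideanSpace ℝ (Fin n) → ℝ} {G : EuclideanSpace ℝ (Fin n) → EuclideanSpace ℝ (Fin n)}
    (h : IsD1p Ω p u G) :
    ∃ φ : ℕ → EuclideanSpace ℝ (Fin n) → ℝ, (∀ j, IsTestFunction Ω (φ j)) ∧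
      IsGradLimit Ω p u G φ := by
  obtain ⟨φ, hφ, hloc, hgrad⟩ := h.approx
  have hum : AEStronglyMeasurable u (volume.restrict Ω) := h.weakGrad.locInt.aestronglyMeasurable
  obtain ⟨κ, hκ, hae⟩ := exists_strictMono_ae_tendsto hΩ hum
    (fun j => (hφ j).smooth.continuous) hloc
  exact ⟨fun j => φ (κ j), fun j => hφ _, fun j => (hφ _).smooth.of_le (by exact_mod_cast le_top),
    fun j => (hφ _).compact, fun j => (hφ _).supp, hae, h.memLp.1, hgrad.comp hκ.tendsto_atTop⟩

/-! ### The test profiles -/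

/-- The smooth non-negative profile `t ↦ (t² + d)^{a/2} - d^{a/2}`, which vanishes at `0` and
approximates `|t|^a` as `d → 0`. -/
noncomputable def testProfile (a d t : ℝ) : ℝ := (t ^ 2 + d) ^ (a / 2) - d ^ (a / 2)

/-- The derivative of `testProfile`. -/
noncomputable def testProfileDeriv (a d t : ℝ) : ℝ := a * t * (t ^ 2 + d) ^ (a / 2 - 1)

/-- The profile `W` whose `p`-th power is `|t|^{p-1} · t² (t² + d)^{a/2-1}` and for which `|W'|^p`
is controlled by `testProfileDeriv`. It approximates `|t|^{(p-1+a)/p}` as `d → 0`. -/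
noncomputable def powerProfile (p a d t : ℝ) : ℝ :=
  |t| ^ (1 + 1 / p) * (t ^ 2 + d) ^ ((a / 2 - 1) / p)

section Profiles

variable {p a d : ℝ}

lemma sq_add_pos (hd : 0 < d) (t : ℝ) : 0 < t ^ 2 + d := by positivity

lemma testProfile_zero : testProfile a d 0 = 0 := by simp [testProfile]

lemma testProfile_nonneg (ha : 0 < a) (hd : 0 < d) (t : ℝ) : 0 ≤ testProfile a d t :=
  sub_nonneg.2 (Real.rpow_le_rpow hd.le (by nlinarith [sq_nonneg t]) (by positivity))

lemma contDiff_testProfile (hd : 0 < d) {m : WithTop ℕ∞} : ContDiff ℝ m (testProfile a d) :=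
  (ContDiff.rpow_const_of_ne (by fun_prop) fun t => (sq_add_pos hd t).ne').sub contDiff_const

lemma hasDerivAt_sq_add_rpow (hd : 0 < d) (b t : ℝ) :
    HasDerivAt (fun t : ℝ => (t ^ 2 + d) ^ b) (2 * t * b * (t ^ 2 + d) ^ (b - 1)) t := by
  have h : HasDerivAt (fun t : ℝ => t ^ 2 + d) (2 * t) t := by
    simpa using (hasDerivAt_pow 2 t).add_const d
  exact h.rpow_const (Or.inl (sq_add_pos hd t).ne')

lemma deriv_testProfile (hd : 0 < d) (t : ℝ) :
    deriv (testProfile a d) t = testProfileDeriv a d t := by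
  have h := ((hasDerivAt_sq_add_rpow hd (a / 2) t).sub_const (d ^ (a / 2))).deriv
  rw [show testProfile a d = fun t => (t ^ 2 + d) ^ (a / 2) - d ^ (a / 2) from rfl, h,
    testProfileDeriv]
  ring

lemma testProfileDeriv_nonneg (ha : 0 < a) (hd : 0 < d) {t : ℝ} (ht : 0 ≤ t) :
    0 ≤ testProfileDeriv a d t :=
  mul_nonneg (by positivity) (Real.rpow_nonneg (sq_add_pos hd t).le _)

lemma abs_testProfileDeriv (ha : 0 < a) (hd : 0 < d) (t : ℝ) :
    |testProfileDeriv a d t| = a * (|t| * (t ^ 2 + d) ^ (a / 2 - 1)) := by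
  rw [testProfileDeriv, abs_mul, abs_mul, abs_of_pos ha,
    abs_of_nonneg (Real.rpow_nonneg (sq_add_pos hd t).le _), mul_assoc]

lemma abs_testProfileDeriv_le (ha : 0 < a) (ha1 : a ≤ 1) (hd : 0 < d) (t : ℝ) :
    |testProfileDeriv a d t| ≤ a * d ^ ((a - 1) / 2) := by
  rw [abs_testProfileDeriv ha hd]
  have h0 := sq_add_pos hd t
  have h1 : |t| ≤ (t ^ 2 + d) ^ ((1 : ℝ) / 2) := by
    rw [← Real.sqrt_eq_rpow, ← Real.sqrt_sq_eq_abs]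
    exact Real.sqrt_le_sqrt (by linarith)
  gcongr
  calc |t| * (t ^ 2 + d) ^ (a / 2 - 1)
      ≤ (t ^ 2 + d) ^ ((1 : ℝ) / 2) * (t ^ 2 + d) ^ (a / 2 - 1) := by gcongr
    _ = (t ^ 2 + d) ^ ((a - 1) / 2) := by rw [← Real.rpow_add h0]; congr 1; ring
    _ ≤ d ^ ((a - 1) / 2) :=
        Real.rpow_le_rpow_of_nonpos hd (by nlinarith [sq_nonneg t]) (by linarith)

/-- The increment of the concave power `t ↦ t^{a/2}` from `d` to `t² + d`, bounded without a
factor `a`. -/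
lemma testProfile_le (ha1 : a ≤ 1) (hd : 0 < d) (t : ℝ) :
    testProfile a d t ≤ t ^ 2 * (t ^ 2 + d) ^ (a / 2 - 1) := by
  have h0 := sq_add_pos hd t
  have h1 : (t ^ 2 + d) ^ (a / 2) = (t ^ 2 + d) ^ (a / 2 - 1) * (t ^ 2 + d) := by
    rw [← Real.rpow_add_one h0.ne']; congr 1; ring
  have h2 : d ^ (a / 2) = d ^ (a / 2 - 1) * d := by
    rw [← Real.rpow_add_one hd.ne']; congr 1; ring
  have h3 : (t ^ 2 + d) ^ (a / 2 - 1) ≤ d ^ (a / 2 - 1) :=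
    Real.rpow_le_rpow_of_nonpos hd (by nlinarith [sq_nonneg t]) (by linarith)
  rw [testProfile, h1, h2]
  nlinarith

lemma testProfile_le_rpow (ha : 0 < a) (ha1 : a ≤ 1) (hd : 0 < d) {t : ℝ} (ht : 0 ≤ t) :
    testProfile a d t ≤ t ^ a := by
  rcases ht.eq_or_lt with rfl | ht
  · rw [testProfile_zero, Real.zero_rpow ha.ne']
  · refine (testProfile_le ha1 hd t).trans ?_
    calc t ^ 2 * (t ^ 2 + d) ^ (a / 2 - 1) ≤ t ^ 2 * (t ^ 2) ^ (a / 2 - 1) := by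
          gcongr ?_ * ?_
          exact Real.rpow_le_rpow_of_nonpos (by positivity) (by linarith) (by linarith)
      _ = t ^ a := by
          rw [← Real.rpow_natCast, ← Real.rpow_mul ht.le, ← Real.rpow_add ht]
          congr 1; push_cast; ring

lemma powerProfile_zero (hp : 1 < p) : powerProfile p a d 0 = 0 := by
  have : 1 + 1 / p ≠ 0 := by positivity
  rw [powerProfile, abs_zero, Real.zero_rpow this, zero_mul]

lemma contDiff_powerProfile (hp : 1 < p) (hd : 0 < d) : ContDiff ℝ 1 (powerProfile p a d) := by
  have h : ContDiff ℝ 1 (fun t : ℝ => ‖t‖ ^ (1 + 1 / p)) :=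
    contDiff_norm_rpow (lt_add_of_pos_right 1 (by positivity))
  exact h.mul (ContDiff.rpow_const_of_ne (by fun_prop) fun t => (sq_add_pos hd t).ne')

lemma abs_deriv_powerProfile_le (hp : 1 < p) (ha : 0 < a) (ha1 : a ≤ 1) (hd : 0 < d) (t : ℝ) :
    |deriv (powerProfile p a d) t| ≤ 4 * (|t| * (t ^ 2 + d) ^ (a / 2 - 1)) ^ (1 / p) := by
  set β := (a / 2 - 1) / p with hβ
  have hp0 : 0 < p := by linarith
  have hip : 0 < 1 / p := by positivity
  have hip1 : 1 / p ≤ 1 := by rw [div_le_one hp0]; exact hp.le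
  have hβ1 : |β| ≤ 1 := by
    rw [hβ, abs_div, abs_of_pos hp0, div_le_one hp0, abs_le]
    constructor <;> linarith
  have hQ := sq_add_pos hd t
  have hder := (hasDerivAt_abs_rpow t (p := 1 + 1 / p) (by linarith)).mul
    (hasDerivAt_sq_add_rpow hd β t)
  have hder' : deriv (powerProfile p a d) t = _ := hder.deriv
  have hQβ := Real.rpow_nonneg hQ.le β
  have hQβ1 := Real.rpow_nonneg hQ.le (β - 1)
  have e1 : |t| ^ (1 + 1 / p - 2) * |t| ≤ |t| ^ (1 / p) := by
    rcases (abs_nonneg t).eq_or_lt with h0 | h0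
    · rw [← h0, mul_zero]; exact Real.rpow_nonneg le_rfl _
    · rw [← Real.rpow_add_one h0.ne']
      exact le_of_eq (by congr 1; ring)
  have e2 : |t| ^ (1 + 1 / p) * |t| * (t ^ 2 + d) ^ (β - 1) ≤ |t| ^ (1 / p) * (t ^ 2 + d) ^ β := by
    have h1 : |t| ^ (1 + 1 / p) = |t| * |t| ^ (1 / p) := by
      rw [Real.rpow_add_of_nonneg (abs_nonneg t) zero_le_one hip.le, Real.rpow_one]
    have h2 : (t ^ 2 + d) ^ β = (t ^ 2 + d) ^ (β - 1) * (t ^ 2 + d) := by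
      rw [← Real.rpow_add_one hQ.ne']; congr 1; ring
    calc |t| ^ (1 + 1 / p) * |t| * (t ^ 2 + d) ^ (β - 1)
        = |t| ^ (1 / p) * ((t ^ 2 + d) ^ (β - 1) * t ^ 2) := by
          rw [h1, ← sq_abs]; ring
      _ ≤ |t| ^ (1 / p) * ((t ^ 2 + d) ^ (β - 1) * (t ^ 2 + d)) := by gcongr; linarith
      _ = _ := by rw [h2]
  have e3 : (|t| * (t ^ 2 + d) ^ (a / 2 - 1)) ^ (1 / p) = |t| ^ (1 / p) * (t ^ 2 + d) ^ β := by
    rw [Real.mul_rpow (abs_nonneg t) (Real.rpow_nonneg hQ.le _), ← Real.rpow_mul hQ.le]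
    congr 2
    rw [hβ]; ring
  rw [hder', e3]
  refine (abs_add_le _ _).trans ?_
  have k1 : |(1 + 1 / p) * |t| ^ (1 + 1 / p - 2) * t * (t ^ 2 + d) ^ β| ≤
      2 * (|t| ^ (1 / p) * (t ^ 2 + d) ^ β) := by
    rw [abs_mul, abs_mul, abs_mul, abs_of_nonneg hQβ, abs_of_pos (by linarith : 0 < 1 + 1 / p),
      abs_of_nonneg (Real.rpow_nonneg (abs_nonneg t) _), mul_assoc (1 + 1 / p), mul_assoc]
    gcongr
    linarith
  have k2 : |(|t| ^ (1 + 1 / p)) * (2 * t * β * (t ^ 2 + d) ^ (β - 1))| ≤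
      2 * (|t| ^ (1 / p) * (t ^ 2 + d) ^ β) := by
    rw [abs_mul, abs_mul, abs_mul, abs_mul, abs_of_nonneg hQβ1, abs_two,
      abs_of_nonneg (Real.rpow_nonneg (abs_nonneg t) _)]
    calc |t| ^ (1 + 1 / p) * (2 * |t| * |β| * (t ^ 2 + d) ^ (β - 1))
        = |β| * (2 * (|t| ^ (1 + 1 / p) * |t| * (t ^ 2 + d) ^ (β - 1))) := by ring
      _ ≤ 1 * (2 * (|t| ^ (1 / p) * (t ^ 2 + d) ^ β)) := by gcongr
      _ = _ := one_mul _
  linarith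

lemma abs_deriv_powerProfile_rpow_le (hp : 1 < p) (ha : 0 < a) (ha1 : a ≤ 1) (hd : 0 < d) (t : ℝ) :
    |deriv (powerProfile p a d) t| ^ p ≤ 4 ^ p / a * |testProfileDeriv a d t| := by
  have hp0 : 0 < p := by linarith
  have hn : 0 ≤ |t| * (t ^ 2 + d) ^ (a / 2 - 1) :=
    mul_nonneg (abs_nonneg t) (Real.rpow_nonneg (sq_add_pos hd t).le _)
  calc |deriv (powerProfile p a d) t| ^ p
      ≤ (4 * (|t| * (t ^ 2 + d) ^ (a / 2 - 1)) ^ (1 / p)) ^ p :=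
        Real.rpow_le_rpow (abs_nonneg _) (abs_deriv_powerProfile_le hp ha ha1 hd t) hp0.le
    _ = 4 ^ p * (|t| * (t ^ 2 + d) ^ (a / 2 - 1)) := by
        rw [Real.mul_rpow (by norm_num) (Real.rpow_nonneg hn _), ← Real.rpow_mul hn,
          one_div_mul_cancel hp0.ne', Real.rpow_one]
    _ = _ := by rw [abs_testProfileDeriv ha hd]; field_simp

lemma abs_deriv_powerProfile_le_const (hp : 1 < p) (ha : 0 < a) (ha1 : a ≤ 1) (hd : 0 < d)
    (t : ℝ) : |deriv (powerProfile p a d) t| ≤ 4 * (d ^ ((a - 1) / 2)) ^ (1 / p) := by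
  refine (abs_deriv_powerProfile_le hp ha ha1 hd t).trans ?_
  have h := abs_testProfileDeriv_le ha ha1 hd t
  rw [abs_testProfileDeriv ha hd] at h
  have hn : 0 ≤ |t| * (t ^ 2 + d) ^ (a / 2 - 1) :=
    mul_nonneg (abs_nonneg t) (Real.rpow_nonneg (sq_add_pos hd t).le _)
  have := le_of_mul_le_mul_left h ha
  gcongr

lemma powerProfile_nonneg (hd : 0 < d) (t : ℝ) : 0 ≤ powerProfile p a d t :=
  mul_nonneg (Real.rpow_nonneg (abs_nonneg t) _) (Real.rpow_nonneg (sq_add_pos hd t).le _)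

/-- The domination which makes the potential term absorbable: up to `|R| / |x|^s`, its density is
at most the `p`-th power of the profile controlled by the energy. -/
lemma rpow_mul_testProfile_le (hp : 1 < p) (ha1 : a ≤ 1) (hd : 0 < d) {t : ℝ}
    (ht : 0 ≤ t) : t ^ (p - 1) * testProfile a d t ≤ powerProfile p a d t ^ p := by
  have hp0 : 0 < p := by linarith
  have hQ := sq_add_pos hd t
  have e : powerProfile p a d t ^ p = t ^ (p - 1) * (t ^ 2 * (t ^ 2 + d) ^ (a / 2 - 1)) := by
    rw [powerProfile, Real.mul_rpow (Real.rpow_nonneg (abs_nonneg t) _) (Real.rpow_nonneg hQ.le _),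
      ← Real.rpow_mul (abs_nonneg t), ← Real.rpow_mul hQ.le, abs_of_nonneg ht,
      div_mul_cancel₀ _ hp0.ne', ← mul_assoc, ← Real.rpow_natCast t 2,
      ← Real.rpow_add_of_nonneg ht (by linarith) (by norm_num)]
    congr 2
    push_cast
    field_simp
    ring
  rw [e]
  exact mul_le_mul_of_nonneg_left (testProfile_le ha1 hd t) (Real.rpow_nonneg ht _)

lemma tendsto_powerProfile (hp : 1 < p) (ha : 0 < a) {t : ℝ} (ht : 0 ≤ t) :
    Tendsto (fun m : ℕ => powerProfile p a (1 / ((m : ℝ) + 1)) t) atTop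
      (𝓝 (t ^ ((p - 1 + a) / p))) := by
  have hp0 : 0 < p := by linarith
  rcases ht.eq_or_lt with rfl | ht
  · simp_rw [powerProfile_zero hp]
    rw [Real.zero_rpow (div_pos (by linarith) hp0).ne']
    exact tendsto_const_nhds
  · have h1 : Tendsto (fun m : ℕ => t ^ 2 + 1 / ((m : ℝ) + 1)) atTop (𝓝 (t ^ 2 + 0)) :=
      tendsto_one_div_add_atTop_nhds_zero_nat.const_add _
    rw [add_zero] at h1
    have h2 := (h1.rpow_const (p := (a / 2 - 1) / p) (Or.inl (by positivity))).const_mul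
      (|t| ^ (1 + 1 / p))
    have e : |t| ^ (1 + 1 / p) * (t ^ 2) ^ ((a / 2 - 1) / p) = t ^ ((p - 1 + a) / p) := by
      rw [abs_of_pos ht, ← Real.rpow_natCast t 2, ← Real.rpow_mul ht.le, ← Real.rpow_add ht]
      congr 1
      push_cast
      field_simp
      ring
    rw [e] at h2
    exact h2

end Profiles

/-! ### Hölder estimates at the critical exponents -/

section Holder

variable {α : Type*} [MeasurableSpace α] {μ : Measure α}

/-- Hölder's inequality with exponents `r`, `q/(p-1)`, `q`. -/
lemma lintegral_enorm_mul_rpow_mul_le {R b c : α → ℝ} (hR : AEStronglyMeasurable R μ)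
    (hb : AEStronglyMeasurable b μ) (hc : AEStronglyMeasurable c μ) {r q p : ℝ} (hr : 0 < r)
    (hq : 0 < q) (hp : 1 ≤ p) (h : 1 / r + p / q = 1) :
    ∫⁻ z, ‖R z‖ₑ * (‖b z‖ₑ ^ (p - 1) * ‖c z‖ₑ) ∂μ ≤
      eLpNorm R (ENNReal.ofReal r) μ * (eLpNorm b (ENNReal.ofReal q) μ ^ (p - 1) *
        eLpNorm c (ENNReal.ofReal q) μ) := by
  have hH := lintegral_rpow_mul_rpow_mul_rpow_le (μ := μ) (F := fun z => ‖R z‖ₑ ^ r)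
    (G := fun z => ‖b z‖ₑ ^ q) (H := fun z => ‖c z‖ₑ ^ q) (hR.enorm.pow_const r)
    (hb.enorm.pow_const q) (hc.enorm.pow_const q) (a := 1 / r) (b := (p - 1) / q) (c := 1 / q)
    (by positivity) (div_nonneg (by linarith) hq.le) (by positivity)
    (by rw [add_assoc, ← add_div, sub_add_cancel]; exact h)
  simp_rw [← ENNReal.rpow_mul, mul_one_div_cancel hr.ne', mul_one_div_cancel hq.ne',
    mul_div_cancel₀ (p - 1) hq.ne', ENNReal.rpow_one] at hH
  rw [eLpNorm_ofReal_eq R hr, eLpNorm_ofReal_eq b hq, eLpNorm_ofReal_eq c hq, ← ENNReal.rpow_mul,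
    one_div_mul_eq_div]
  simp_rw [← mul_assoc]
  exact hH

lemma lintegral_enorm_mul_le {V c : α → ℝ} (hV : AEStronglyMeasurable V μ)
    (hc : AEStronglyMeasurable c μ) {m P : ℝ} (hm : 0 < m) (hP : 0 < P) (h : 1 / m + 1 / P = 1) :
    ∫⁻ z, ‖V z‖ₑ * ‖c z‖ₑ ∂μ ≤
      eLpNorm V (ENNReal.ofReal m) μ * eLpNorm c (ENNReal.ofReal P) μ := by
  have hH := ENNReal.lintegral_mul_norm_pow_le (μ := μ) (hV.enorm.pow_const m)
    (hc.enorm.pow_const P) (p := 1 / m) (q := 1 / P) (by positivity) (by positivity) h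
  simp_rw [← ENNReal.rpow_mul, mul_one_div_cancel hm.ne', mul_one_div_cancel hP.ne',
    ENNReal.rpow_one] at hH
  rwa [eLpNorm_ofReal_eq V hm, eLpNorm_ofReal_eq c hP]

lemma memLp_ofReal_of_one_le_of_le {V : α → ℝ} {m r : ℝ} (h1 : MemLp V 1 μ)
    (hr : MemLp V (ENNReal.ofReal r) μ) (hm : 1 ≤ m) (hmr : m ≤ r) :
    MemLp V (ENNReal.ofReal m) μ := by
  have hm0 : 0 < m := by linarith
  have hr0 : 0 < r := by linarith
  refine ⟨h1.1, ?_⟩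
  rw [eLpNorm_ofReal_eq V hm0]
  refine ENNReal.rpow_lt_top_of_nonneg (by positivity) (ne_top_of_le_ne_top ?_
    (lintegral_mono (g := fun z => ‖V z‖ₑ + ‖V z‖ₑ ^ r) fun z => ?_))
  · rw [lintegral_add_left' h1.1.enorm, ← eLpNorm_one_eq_lintegral_enorm,
      ← eLpNorm_ofReal_rpow V hr0]
    exact ENNReal.add_ne_top.2 ⟨h1.eLpNorm_ne_top,
      ENNReal.rpow_ne_top_of_nonneg hr0.le hr.eLpNorm_ne_top⟩
  · rcases le_total ‖V z‖ₑ 1 with h | h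
    · refine le_add_right ?_
      simpa using ENNReal.rpow_le_rpow_of_exponent_ge h hm
    · exact le_add_left (ENNReal.rpow_le_rpow_of_exponent_le h hmr)

/-- Hölder's inequality for the flux `|G|^{p-2} G`. -/
lemma lintegral_enorm_flux_le {E : Type*} [NormedAddCommGroup E] [InnerProductSpace ℝ E]
    {G H : α → E} (hG : AEStronglyMeasurable G μ) (hH : AEStronglyMeasurable H μ) {p : ℝ}
    (hp : 1 < p) :
    ∫⁻ z, ‖‖G z‖ ^ (p - 2) * inner ℝ (G z) (H z)‖ₑ ∂μ ≤
      eLpNorm G (ENNReal.ofReal p) μ ^ (p - 1) * eLpNorm H (ENNReal.ofReal p) μ := by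
  have hp0 : 0 < p := by linarith
  have hHo := ENNReal.lintegral_mul_norm_pow_le (μ := μ) (hG.enorm.pow_const p)
    (hH.enorm.pow_const p) (p := (p - 1) / p) (q := 1 / p) (div_nonneg (by linarith) hp0.le)
    (by positivity) (by field_simp; ring)
  simp_rw [← ENNReal.rpow_mul, mul_div_cancel₀ (p - 1) hp0.ne', mul_one_div_cancel hp0.ne',
    ENNReal.rpow_one] at hHo
  rw [eLpNorm_ofReal_eq G hp0, eLpNorm_ofReal_eq H hp0, ← ENNReal.rpow_mul, one_div_mul_eq_div]
  refine le_trans (lintegral_mono fun z => ?_) hHo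
  rw [← ofReal_norm (G z), ← ofReal_norm (H z), ← ofReal_norm,
    ENNReal.ofReal_rpow_of_nonneg (norm_nonneg _) (by linarith),
    ← ENNReal.ofReal_mul (Real.rpow_nonneg (norm_nonneg _) _)]
  refine ENNReal.ofReal_le_ofReal ?_
  rw [norm_mul, Real.norm_of_nonneg (Real.rpow_nonneg (norm_nonneg _) _)]
  rcases (norm_nonneg (G z)).eq_or_lt with h0 | h0
  · have : G z = 0 := norm_eq_zero.1 h0.symm
    simp [this, Real.zero_rpow (by linarith : p - 1 ≠ 0)]
  · calc ‖G z‖ ^ (p - 2) * ‖inner ℝ (G z) (H z)‖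
        ≤ ‖G z‖ ^ (p - 2) * (‖G z‖ * ‖H z‖) := by gcongr; exact norm_inner_le_norm _ _
      _ = ‖G z‖ ^ (p - 1) * ‖H z‖ := by
          rw [← mul_assoc, ← Real.rpow_add_one h0.ne']; congr 2; ring

lemma aestronglyMeasurable_flux {E : Type*} [NormedAddCommGroup E] [InnerProductSpace ℝ E]
    {G H : α → E} (hG : AEStronglyMeasurable G μ) (hH : AEStronglyMeasurable H μ) (p : ℝ) :
    AEStronglyMeasurable (fun z => ‖G z‖ ^ (p - 2) * inner ℝ (G z) (H z)) μ :=
  (hG.norm.aemeasurable.pow_const _).aestronglyMeasurable.mul (hG.inner hH)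

/-- The part of `R ∈ L^r` living on `{0 < u < η}` is small in `L^r` as `η → 0`. -/
lemma tendsto_eLpNorm_indicator_mul {R u : α → ℝ} {r : ℝ} (hr : 0 < r)
    (hR : MemLp R (ENNReal.ofReal r) μ) (hu : AEStronglyMeasurable u μ) :
    Tendsto (fun m : ℕ => eLpNorm
      (fun z => (Set.Ioo 0 (1 / ((m : ℝ) + 1))).indicator (1 : ℝ → ℝ) (u z) * R z)
      (ENNReal.ofReal r) μ) atTop (𝓝 0) := by
  have hmeas : ∀ m : ℕ, AEStronglyMeasurable
      (fun z => (Set.Ioo 0 (1 / ((m : ℝ) + 1))).indicator (1 : ℝ → ℝ) (u z) * R z) μ := fun m =>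
    (((measurable_one.indicator measurableSet_Ioo).comp_aemeasurable
      hu.aemeasurable).aestronglyMeasurable).mul hR.1
  have hdct : Tendsto (fun m : ℕ => ∫⁻ z,
      ‖(Set.Ioo 0 (1 / ((m : ℝ) + 1))).indicator (1 : ℝ → ℝ) (u z) * R z‖ₑ ^ r ∂μ) atTop
      (𝓝 (∫⁻ _, 0 ∂μ)) := by
    refine tendsto_lintegral_of_dominated_convergence' (fun z => ‖R z‖ₑ ^ r)
      (fun m => (hmeas m).enorm.pow_const r) (fun m => ae_of_all _ fun z => ?_) ?_
      (ae_of_all _ fun z => ?_)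
    · refine ENNReal.rpow_le_rpow ?_ hr.le
      by_cases h : u z ∈ Set.Ioo 0 (1 / ((m : ℝ) + 1))
      · rw [Set.indicator_of_mem h]; simp
      · rw [Set.indicator_of_notMem h]; simp
    · rw [← eLpNorm_ofReal_rpow R hr]
      exact ENNReal.rpow_ne_top_of_nonneg hr.le hR.eLpNorm_ne_top
    · refine tendsto_const_nhds.congr' ?_
      by_cases hz : 0 < u z
      · filter_upwards [tendsto_one_div_add_atTop_nhds_zero_nat.eventually_le_const hz] with m hm
        rw [Set.indicator_of_notMem (fun h => absurd h.2 (not_lt.2 hm))]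
        simp [ENNReal.zero_rpow_of_pos hr]
      · refine Eventually.of_forall fun m => ?_
        dsimp only
        rw [Set.indicator_of_notMem (fun h => hz h.1)]
        simp [ENNReal.zero_rpow_of_pos hr]
  simp_rw [eLpNorm_ofReal_eq _ hr]
  have := (ENNReal.continuous_rpow_const (y := 1 / r)).tendsto _ |>.comp hdct
  simpa [ENNReal.zero_rpow_of_pos (inv_pos.2 hr), Function.comp_def] using this

end Holder

/-! ### Testing the inequality with a function of the solution -/

/-- A differential inequality holding for non-negative test functions may be tested with `F ∘ u`,
where `F ≥ 0` is smooth with bounded derivative and `F 0 = 0`, as soon as integration against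
the right side `g` is continuous along gradient limits. -/
lemma ofReal_integral_deriv_mul_le {n : ℕ} {Ω : Set (EuclideanSpace ℝ (Fin n))} {p : ℝ}
    (hp : 1 < p)
    {u g : EuclideanSpace ℝ (Fin n) → ℝ} {G : EuclideanSpace ℝ (Fin n) → EuclideanSpace ℝ (Fin n)}
    (hg : AEStronglyMeasurable g (volume.restrict Ω))
    (hG : MemLp G (ENNReal.ofReal p) (volume.restrict Ω))
    {φ : ℕ → EuclideanSpace ℝ (Fin n) → ℝ} (hφ : ∀ j, IsTestFunction Ω (φ j))
    (hlim : IsGradLimit Ω p u G φ)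
    (hsub : ∀ φ : EuclideanSpace ℝ (Fin n) → ℝ, IsTestFunction Ω φ → (∀ z, 0 ≤ φ z) →
      ∫ z in Ω, ‖G z‖ ^ (p - 2) * inner ℝ (G z) (gradient φ z) ≤ ∫ z in Ω, g z * φ z)
    (hconv : ∀ v H ψ, IsGradLimit Ω p v H ψ →
      Tendsto (fun j => ∫⁻ z in Ω, ‖g z‖ₑ * ‖ψ j z - v z‖ₑ) atTop (𝓝 0))
    {F : ℝ → ℝ} (hF : ContDiff ℝ ((⊤ : ℕ∞) : WithTop ℕ∞) F) (hF0 : F 0 = 0) (hFn : ∀ t, 0 ≤ F t)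
    {B : ℝ} (hB : ∀ t, |deriv F t| ≤ B) :
    ENNReal.ofReal (∫ z in Ω, deriv F (u z) * ‖G z‖ ^ p) ≤
      ∫⁻ z in Ω, ‖g z‖ₑ * ‖F (u z)‖ₑ := by
  have hp0 : 0 < p := by linarith
  have hF1 : ContDiff ℝ 1 F := hF.of_le (by exact_mod_cast le_top)
  have hlimF := hlim.comp hp.le hG hF1 hF0 hB
  set ψ : ℕ → EuclideanSpace ℝ (Fin n) → ℝ := fun j z => F (φ j z) with hψ
  have htest : ∀ j, IsTestFunction Ω (ψ j) := fun j =>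
    ⟨hF.comp (hφ j).smooth, hlimF.compact j, hlimF.supp j⟩
  have hgψ : ∀ j, AEStronglyMeasurable (gradient (ψ j)) (volume.restrict Ω) :=
    fun j => (continuous_gradient (hlimF.contDiff j)).aestronglyMeasurable
  have hgψm : ∀ j, MemLp (gradient (ψ j)) (ENNReal.ofReal p) (volume.restrict Ω) := fun j =>
    (continuous_gradient (hlimF.contDiff j)).memLp_of_hasCompactSupport
      (((hlimF.compact j).fderiv ℝ).comp_left (map_zero _))
  have hGp := ENNReal.rpow_ne_top_of_nonneg (by linarith : 0 ≤ p - 1) hG.eLpNorm_ne_top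
  have hleft : Tendsto (fun j => ∫ z in Ω, ‖G z‖ ^ (p - 2) * inner ℝ (G z) (gradient (ψ j) z))
      atTop (𝓝 (∫ z in Ω, ‖G z‖ ^ (p - 2) * inner ℝ (G z) (deriv F (u z) • G z))) := by
    refine tendsto_integral_of_L1 _ (aestronglyMeasurable_flux hG.1 hlimF.aesm p)
      (Eventually.of_forall fun j => ⟨aestronglyMeasurable_flux hG.1 (hgψ j) p, ?_⟩) ?_
    · exact (lintegral_enorm_flux_le hG.1 (hgψ j) hp).trans_lt
        (ENNReal.mul_lt_top hGp.lt_top (hgψm j).eLpNorm_lt_top)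
    · have h0 := ENNReal.Tendsto.const_mul hlimF.grad_tendsto (Or.inr hGp)
      rw [mul_zero] at h0
      refine tendsto_of_tendsto_of_tendsto_of_le_of_le tendsto_const_nhds h0 (fun _ => zero_le)
        fun j => ?_
      refine le_trans (le_of_eq (lintegral_congr fun z => ?_))
        (lintegral_enorm_flux_le hG.1 ((hgψ j).sub hlimF.aesm) hp)
      rw [← mul_sub, ← inner_sub_right]
      rfl
  have hval : ∫ z in Ω, deriv F (u z) * ‖G z‖ ^ p =
      ∫ z in Ω, ‖G z‖ ^ (p - 2) * inner ℝ (G z) (deriv F (u z) • G z) := by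
    refine integral_congr_ae (ae_of_all _ fun z => ?_)
    simp only [inner_smul_right, real_inner_self_eq_norm_sq]
    rcases (norm_nonneg (G z)).eq_or_lt with h0 | h0
    · simp [← h0, Real.zero_rpow hp0.ne']
    · have : ‖G z‖ ^ p = ‖G z‖ ^ (p - 2) * ‖G z‖ ^ 2 := by
        rw [← Real.rpow_natCast, ← Real.rpow_add h0]; congr 1; push_cast; ring
      rw [this]; ring
  have hright : ∀ j, ENNReal.ofReal
      (∫ z in Ω, ‖G z‖ ^ (p - 2) * inner ℝ (G z) (gradient (ψ j) z)) ≤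
      (∫⁻ z in Ω, ‖g z‖ₑ * ‖F (u z)‖ₑ) + ∫⁻ z in Ω, ‖g z‖ₑ * ‖ψ j z - F (u z)‖ₑ := by
    intro j
    have hFu : AEStronglyMeasurable (fun z => F (u z)) (volume.restrict Ω) :=
      aestronglyMeasurable_of_tendsto_ae atTop
        (fun j => (hlimF.contDiff j).continuous.aestronglyMeasurable) hlimF.ae_tendsto
    calc _ ≤ ENNReal.ofReal (∫ z in Ω, g z * ψ j z) :=
          ENNReal.ofReal_le_ofReal (hsub _ (htest j) fun z => hFn _)
      _ ≤ ‖∫ z in Ω, g z * ψ j z‖ₑ := Real.ofReal_le_enorm _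
      _ ≤ ∫⁻ z in Ω, ‖g z * ψ j z‖ₑ := enorm_integral_le_lintegral_enorm _
      _ ≤ ∫⁻ z in Ω, (‖g z‖ₑ * ‖F (u z)‖ₑ + ‖g z‖ₑ * ‖ψ j z - F (u z)‖ₑ) := by
          refine lintegral_mono fun z => ?_
          rw [enorm_mul, ← mul_add]
          refine mul_le_mul' le_rfl ?_
          calc ‖ψ j z‖ₑ = ‖F (u z) + (ψ j z - F (u z))‖ₑ := by congr 1; ring
            _ ≤ _ := enorm_add_le _ _
      _ = _ := lintegral_add_left' (hg.enorm.mul hFu.enorm) _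
  have h0 := (hconv _ _ _ hlimF).const_add (∫⁻ z in Ω, ‖g z‖ₑ * ‖F (u z)‖ₑ)
  rw [add_zero] at h0
  rw [hval]
  exact le_of_tendsto_of_tendsto' ((ENNReal.continuous_ofReal.tendsto _).comp hleft) h0 hright

/-! ### Exponents -/

lemma rPrime_eq {n : ℕ} {p s : ℝ} (hp0 : 0 < p) (hpn : p < n) (hsp : s < p) :
    rPrime n p s = n / (p - s) := by
  have h1 : (n : ℝ) - p ≠ 0 := by linarith
  have h2 : p - s ≠ 0 := by linarith
  have h3 : hardySobolevConj n p s - p = p * (p - s) / (n - p) := by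
    rw [hardySobolevConj]; field_simp; ring
  rw [rPrime, h3, sobolevConj]
  field_simp

/-- The Hardy–Sobolev inequality with the weight and the exponent `q` for which
`|R| |u|^{p-1} |v| / |x|^s` is controlled by Hölder's inequality, that is `1 / r' + p / q = 1`. -/
lemma exists_hardySobolev_weight {n k : ℕ} (hk2 : 2 ≤ k) (hkn : k ≤ n) {p s : ℝ} (hp1 : 1 < p)
    (hpn : p < n) (hs0 : 0 ≤ s) (hsp : s < p) (hbound : s * ((n : ℝ) - k) < k * ((n : ℝ) - p)) :
    ∃ (q : ℝ) (C : ENNReal), 0 < q ∧ 1 / rPrime n p s + p / q = 1 ∧ C ≠ ⊤ ∧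
      ∀ w : EuclideanSpace ℝ (Fin n) → ℝ, ContDiff ℝ 1 w → HasCompactSupport w →
        eLpNorm (fun z => cylNorm k z ^ (-(s / p)) * w z) (ENNReal.ofReal q) volume ≤
          C * eLpNorm (fderiv ℝ w) (ENNReal.ofReal p) volume := by
  have hp0 : 0 < p := by linarith
  have hn0 : (0 : ℝ) < n := by linarith
  have hnp : 0 < (n : ℝ) - p := by linarith
  have hden : 0 < (n : ℝ) - p + s := by linarith
  set σ : ℝ := s * n / (n - p + s) with hσ
  have hq : hardySobolevConj n p σ = n * p / (n - p + s) := by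
    rw [hardySobolevConj, hσ]; field_simp; ring
  have hσq : σ / hardySobolevConj n p σ = s / p := by
    rw [hq, hσ]; field_simp
  have hσ0 : 0 ≤ σ := by positivity
  have hσp : σ < p := by
    rw [hσ, div_lt_iff₀ hden]; nlinarith
  have hσk : σ < k := by
    rw [hσ, div_lt_iff₀ hden]; nlinarith
  obtain ⟨C, hC, h⟩ := hardySobolev_fderiv hk2 hkn hp1 hσ0 hσp hσk hpn
  refine ⟨hardySobolevConj n p σ, C, by rw [hq]; positivity, ?_, hC, ?_⟩
  · rw [rPrime_eq hp0 hpn hsp, hq]; field_simp; ring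
  · rw [hσq] at h; exact h

/-! ### The right side of the inequality -/

/-- The right side is controlled by `|R| |ω u|^{p-1} ω + |V₀|`, where `ω = |x|^{-s/p}`. -/
lemma enorm_rhs_le {p s : ℝ} (hp1 : 1 < p) {ρ : ℝ} (hρ : 0 ≤ ρ) (R V u : ℝ) :
    ‖R * (|u| ^ (p - 2) / ρ ^ s) * u + V‖ₑ ≤
      ‖R‖ₑ * (‖ρ ^ (-(s / p)) * u‖ₑ ^ (p - 1) * ‖ρ ^ (-(s / p))‖ₑ) + ‖V‖ₑ := by
  have hp0 : 0 < p := by linarith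
  refine (enorm_add_le _ _).trans (add_le_add (le_of_eq ?_) le_rfl)
  have hω : 0 ≤ ρ ^ (-(s / p)) := Real.rpow_nonneg hρ _
  rw [mul_assoc, enorm_mul]
  congr 1
  rw [← ofReal_norm, ← ofReal_norm (ρ ^ (-(s / p)) * u), ← ofReal_norm (ρ ^ (-(s / p))),
    ENNReal.ofReal_rpow_of_nonneg (norm_nonneg _) (by linarith),
    ← ENNReal.ofReal_mul (Real.rpow_nonneg (norm_nonneg _) _)]
  congr 1
  -- This also holds at `ρ = 0`, where both sides are `0` if `0 < s` and `1` if `s = 0`.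
  have e1 : (ρ ^ s)⁻¹ = (ρ ^ (-(s / p))) ^ (p - 1) * ρ ^ (-(s / p)) := by
    have : (ρ ^ (-(s / p))) ^ (p - 1) * ρ ^ (-(s / p)) = (ρ ^ (-(s / p))) ^ p := by
      nth_rewrite 2 [← Real.rpow_one (ρ ^ (-(s / p)))]
      rw [← Real.rpow_add_of_nonneg hω (by linarith) zero_le_one, sub_add_cancel]
    rw [this, ← Real.rpow_mul hρ, ← Real.rpow_neg hρ]
    congr 1; field_simp
  -- For `u = 0` both sides vanish, whatever the value of `0 ^ (p - 2)`.
  have e2 : |u| ^ (p - 2) * |u| = |u| ^ (p - 1) := by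
    rcases (abs_nonneg u).eq_or_lt with h0 | h0
    · rw [← h0, mul_zero, Real.zero_rpow (by linarith)]
    · rw [← Real.rpow_add_one h0.ne']; congr 1; ring
  simp only [Real.norm_eq_abs, abs_mul, abs_div]
  rw [abs_of_nonneg (Real.rpow_nonneg (abs_nonneg u) _), abs_of_nonneg (Real.rpow_nonneg hρ s),
    abs_of_nonneg hω, Real.mul_rpow hω (abs_nonneg u), div_eq_mul_inv, e1, ← e2]
  ring

lemma enorm_mul_rpow_mul_enorm_mul {p ω x y : ℝ} (hp : 1 < p) (hω : 0 ≤ ω) (hx : 0 ≤ x)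
    (hy : 0 ≤ y) :
    ‖ω * x‖ₑ ^ (p - 1) * ‖ω * y‖ₑ = ENNReal.ofReal (ω ^ p * (x ^ (p - 1) * y)) := by
  rw [Real.enorm_of_nonneg (mul_nonneg hω hx), Real.enorm_of_nonneg (mul_nonneg hω hy),
    ENNReal.ofReal_rpow_of_nonneg (mul_nonneg hω hx) (by linarith),
    ← ENNReal.ofReal_mul (Real.rpow_nonneg (mul_nonneg hω hx) _), Real.mul_rpow hω hx]
  have : ω ^ p = ω ^ (p - 1) * ω := by
    nth_rewrite 3 [← Real.rpow_one ω]
    rw [← Real.rpow_add_of_nonneg hω (by linarith) zero_le_one, sub_add_cancel]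
  rw [this]
  congr 1
  ring

/-- Splitting of the potential term at the level `η`: below `η` it is absorbed by the power
profile, above `η` it is controlled by the `p`-homogeneous term. -/
lemma enorm_potential_le {p a d η ω R t : ℝ} (hp : 1 < p) (ha : 0 < a) (ha1 : a ≤ 1) (hd : 0 < d)
    (hη : 0 < η) (hω : 0 ≤ ω) (ht : 0 ≤ t) :
    ‖R‖ₑ * (‖ω * t‖ₑ ^ (p - 1) * ‖ω * testProfile a d t‖ₑ) ≤
      ‖(Set.Ioo 0 η).indicator (1 : ℝ → ℝ) t * R‖ₑ *
        (‖ω * powerProfile p a d t‖ₑ ^ (p - 1) * ‖ω * powerProfile p a d t‖ₑ) +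
      ENNReal.ofReal (η ^ (a - 1)) * (‖R‖ₑ * (‖ω * t‖ₑ ^ (p - 1) * ‖ω * t‖ₑ)) := by
  have hf := testProfile_nonneg ha hd t
  have hW := powerProfile_nonneg (p := p) (a := a) hd t
  have hωp : 0 ≤ ω ^ p := Real.rpow_nonneg hω _
  have hWp : powerProfile p a d t ^ (p - 1) * powerProfile p a d t = powerProfile p a d t ^ p := by
    nth_rewrite 2 [← Real.rpow_one (powerProfile p a d t)]
    rw [← Real.rpow_add_of_nonneg hW (by linarith) zero_le_one, sub_add_cancel]
  rw [enorm_mul_rpow_mul_enorm_mul hp hω ht hf, enorm_mul_rpow_mul_enorm_mul hp hω hW hW,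
    enorm_mul_rpow_mul_enorm_mul hp hω ht ht, hWp]
  rcases ht.eq_or_lt with rfl | ht
  · simp [testProfile_zero]
  rcases lt_or_ge t η with h | h
  · rw [Set.indicator_of_mem (show t ∈ Set.Ioo 0 η from ⟨ht, h⟩), Pi.one_apply, one_mul]
    refine le_add_right ?_
    gcongr
    exact rpow_mul_testProfile_le hp ha1 hd ht.le
  · refine le_add_left ?_
    have e : t ^ a ≤ η ^ (a - 1) * t := by
      have : t ^ a = t ^ (a - 1) * t := by rw [← Real.rpow_add_one ht.ne', sub_add_cancel]
      rw [this]
      gcongr ?_ * t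
      exact Real.rpow_le_rpow_of_nonpos hη h (by linarith)
    rw [mul_left_comm (ENNReal.ofReal _), ← ENNReal.ofReal_mul (Real.rpow_nonneg hη.le _)]
    refine mul_le_mul' le_rfl (ENNReal.ofReal_le_ofReal ?_)
    calc ω ^ p * (t ^ (p - 1) * testProfile a d t)
        ≤ ω ^ p * (t ^ (p - 1) * (η ^ (a - 1) * t)) := by
          gcongr
          exact (testProfile_le_rpow ha ha1 hd ht.le).trans e
      _ = _ := by ring

lemma enorm_testProfile_le {a d t : ℝ} (ha : 0 < a) (ha1 : a ≤ 1) (hd : 0 < d) (ht : 0 ≤ t) :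
    ‖testProfile a d t‖ₑ ≤ 1 + ‖t‖ₑ := by
  rw [Real.enorm_of_nonneg (testProfile_nonneg ha hd t), Real.enorm_of_nonneg ht,
    ← ENNReal.ofReal_one, ← ENNReal.ofReal_add zero_le_one ht]
  refine ENNReal.ofReal_le_ofReal ((testProfile_le_rpow ha ha1 hd ht).trans ?_)
  rcases le_total t 1 with h | h
  · exact (Real.rpow_le_one ht h ha.le).trans (by linarith)
  · calc t ^ a ≤ t ^ (1 : ℝ) := Real.rpow_le_rpow_of_exponent_le h ha1
      _ = t := Real.rpow_one t
      _ ≤ _ := by linarith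

/-! ### The uniform energy estimate -/

/-- The gradient of `powerProfile p a d ∘ u` is controlled by the energy of the test profile. -/
lemma eLpNorm_deriv_powerProfile_smul_rpow_le {n : ℕ} {Ω : Set (EuclideanSpace ℝ (Fin n))}
    {p a d : ℝ} (hp : 1 < p) (ha : 0 < a) (ha1 : a ≤ 1) (hd : 0 < d)
    {u : EuclideanSpace ℝ (Fin n) → ℝ} {G : EuclideanSpace ℝ (Fin n) → EuclideanSpace ℝ (Fin n)}
    (hu0 : ∀ᵐ z ∂(volume.restrict Ω), 0 ≤ u z) :
    eLpNorm (fun z => deriv (powerProfile p a d) (u z) • G z) (ENNReal.ofReal p)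
      (volume.restrict Ω) ^ p ≤
      ENNReal.ofReal (4 ^ p / a) *
        ∫⁻ z in Ω, ENNReal.ofReal (testProfileDeriv a d (u z) * ‖G z‖ ^ p) := by
  have hp0 : 0 < p := by linarith
  rw [eLpNorm_ofReal_rpow _ hp0, ← lintegral_const_mul' _ _ ENNReal.ofReal_ne_top]
  refine lintegral_mono_ae (hu0.mono fun z hz => ?_)
  rw [← ofReal_norm, ENNReal.ofReal_rpow_of_nonneg (norm_nonneg _) hp0.le, norm_smul,
    Real.mul_rpow (norm_nonneg _) (norm_nonneg _), ← ENNReal.ofReal_mul (by positivity),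
    ← mul_assoc, Real.norm_eq_abs]
  refine ENNReal.ofReal_le_ofReal (mul_le_mul_of_nonneg_right ?_ (by positivity))
  have := abs_deriv_powerProfile_rpow_le hp ha ha1 hd (u z)
  rwa [abs_of_nonneg (testProfileDeriv_nonneg ha hd hz)] at this

/-- The energy of the test profiles is bounded uniformly in the
regularization `d`. The part of the potential term below a small level of `u` is absorbed. -/
lemma exists_energy_bound {n k : ℕ} (hk2 : 2 ≤ k) (hkn : k ≤ n) {p s : ℝ} (hp1 : 1 < p)
    (hpn : p < n) (hs0 : 0 ≤ s) (hsp : s < p) (hbound : s * ((n : ℝ) - k) < k * ((n : ℝ) - p))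
    {Ω : Set (EuclideanSpace ℝ (Fin n))} (hΩ : IsOpen Ω)
    {R V₀ u : EuclideanSpace ℝ (Fin n) → ℝ}
    {G : EuclideanSpace ℝ (Fin n) → EuclideanSpace ℝ (Fin n)}
    (hR : MemLp R (ENNReal.ofReal (rPrime n p s)) (volume.restrict Ω))
    (hV₁ : MemLp V₀ 1 (volume.restrict Ω))
    (hVr : MemLp V₀ (ENNReal.ofReal (rPrime n p s)) (volume.restrict Ω))
    (hu0 : ∀ᵐ z ∂(volume.restrict Ω), 0 ≤ u z) (hG : IsD1p Ω p u G)
    (hsub : ∀ φ : EuclideanSpace ℝ (Fin n) → ℝ, IsTestFunction Ω φ → (∀ z, 0 ≤ φ z) →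
      ∫ z in Ω, ‖G z‖ ^ (p - 2) * inner ℝ (G z) (gradient φ z) ≤
        ∫ z in Ω, (R z * (|u z| ^ (p - 2) / cylNorm k z ^ s) * u z + V₀ z) * φ z)
    {a : ℝ} (ha : 0 < a) (ha1 : a ≤ 1) :
    ∃ M : ENNReal, M ≠ ⊤ ∧ ∀ d : ℝ, 0 < d →
      ∫⁻ z in Ω, ENNReal.ofReal (testProfileDeriv a d (u z) * ‖G z‖ ^ p) ≤ M := by
  have hp0 : 0 < p := by linarith
  have hn0 : (0 : ℝ) < n := by linarith
  have hnp : 0 < (n : ℝ) - p := by linarith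
  obtain ⟨φ, hφ, hlim⟩ := hG.exists_isGradLimit hΩ
  obtain ⟨S, hS, hSob⟩ := sobolev_fderiv (n := n) hp1 hpn
  obtain ⟨q, C, hq, hqr, hC, hHS⟩ := exists_hardySobolev_weight hk2 hkn hp1 hpn hs0 hsp hbound
  set P := sobolevConj n p with hP
  set r := rPrime n p s with hr
  have hr_eq : r = n / (p - s) := rPrime_eq hp0 hpn hsp
  have hr0 : 0 < r := by rw [hr_eq]; exact div_pos hn0 (by linarith)
  have hP0 : 0 < P := div_pos (mul_pos hn0 hp0) hnp
  have hSob' : ∀ w : EuclideanSpace ℝ (Fin n) → ℝ, ContDiff ℝ 1 w → HasCompactSupport w →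
      eLpNorm (fun z => (1 : ℝ) * w z) (ENNReal.ofReal P) volume ≤
        S * eLpNorm (fderiv ℝ w) (ENNReal.ofReal p) volume := by simpa using hSob
  -- The exponent dual to `p*` lies between `1` and `r'`.
  obtain ⟨m, hm1, hmr, hmP⟩ : ∃ m : ℝ, 1 ≤ m ∧ m ≤ r ∧ 1 / m + 1 / P = 1 := by
    have hden : 0 < (n : ℝ) * p - n + p := by nlinarith
    refine ⟨n * p / (n * p - n + p), ?_, ?_, ?_⟩
    · rw [le_div_iff₀ hden]; linarith
    · rw [hr_eq, div_le_div_iff₀ hden (by linarith)]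
      nlinarith [mul_nonneg hs0 hp0.le, mul_nonneg (sub_nonneg.2 hp1.le) hnp.le]
    · rw [hP, sobolevConj]; field_simp; ring
  have hVm := memLp_ofReal_of_one_le_of_le hV₁ hVr hm1 hmr
  set μ := volume.restrict Ω with hμ
  set ω : EuclideanSpace ℝ (Fin n) → ℝ := fun z => cylNorm k z ^ (-(s / p)) with hω
  have hωm : Measurable ω := (continuous_cylNorm k).measurable.pow_const _
  have hω0 : ∀ z, 0 ≤ ω z := fun z => Real.rpow_nonneg (cylNorm_nonneg k z) _
  have hum : AEStronglyMeasurable u μ := hG.weakGrad.locInt.aestronglyMeasurable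
  have hωu : AEStronglyMeasurable (fun z => ω z * u z) μ := hωm.aestronglyMeasurable.mul hum
  have hωu_fin : eLpNorm (fun z => ω z * u z) (ENNReal.ofReal q) μ ≠ ⊤ :=
    ne_top_of_le_ne_top (ENNReal.mul_ne_top hC hG.memLp.eLpNorm_ne_top)
      (hlim.eLpNorm_mul_le hp1.le hC hωm hHS)
  have hu_fin : eLpNorm u (ENNReal.ofReal P) μ ≠ ⊤ := by
    have := hlim.eLpNorm_mul_le hp1.le hS measurable_const hSob'
    simp only [one_mul] at this
    exact ne_top_of_le_ne_top (ENNReal.mul_ne_top hS hG.memLp.eLpNorm_ne_top) this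
  set g : EuclideanSpace ℝ (Fin n) → ℝ := fun z =>
    R z * (|u z| ^ (p - 2) / cylNorm k z ^ s) * u z + V₀ z with hg
  have hgm : AEStronglyMeasurable g μ := by
    refine ((hR.1.mul ?_).mul hum).add hV₁.1
    exact (((hum.norm.aemeasurable).pow_const (p - 2)).div
      (((continuous_cylNorm k).measurable.pow_const s).aemeasurable)).aestronglyMeasurable
  have hgle : ∀ z (y : ℝ), ‖g z‖ₑ * ‖y‖ₑ ≤
      ‖R z‖ₑ * (‖ω z * u z‖ₑ ^ (p - 1) * ‖ω z * y‖ₑ) + ‖V₀ z‖ₑ * ‖y‖ₑ := by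
    intro z y
    refine (mul_le_mul' (enorm_rhs_le hp1 (cylNorm_nonneg k z) (R z) (V₀ z) (u z)) le_rfl).trans
      (le_of_eq ?_)
    rw [enorm_mul (ω z) y]
    ring
  have hlintg : ∀ y : EuclideanSpace ℝ (Fin n) → ℝ, AEStronglyMeasurable y μ →
      ∫⁻ z, ‖g z‖ₑ * ‖y z‖ₑ ∂μ ≤
        (∫⁻ z, ‖R z‖ₑ * (‖ω z * u z‖ₑ ^ (p - 1) * ‖ω z * y z‖ₑ) ∂μ) +
          ∫⁻ z, ‖V₀ z‖ₑ * ‖y z‖ₑ ∂μ := by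
    intro y hy
    refine (lintegral_mono fun z => hgle z (y z)).trans (le_of_eq (lintegral_add_right' _ ?_))
    exact hV₁.1.enorm.mul hy.enorm
  have hconv : ∀ v H ψ, IsGradLimit Ω p v H ψ →
      Tendsto (fun j => ∫⁻ z, ‖g z‖ₑ * ‖ψ j z - v z‖ₑ ∂μ) atTop (𝓝 0) := by
    intro v H ψ h
    have hvm : AEStronglyMeasurable v μ := aestronglyMeasurable_of_tendsto_ae atTop
      (fun j => (h.contDiff j).continuous.aestronglyMeasurable) h.ae_tendsto
    have hym : ∀ j, AEStronglyMeasurable (fun z => ψ j z - v z) μ := fun j =>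
      (h.contDiff j).continuous.aestronglyMeasurable.sub hvm
    have t1 := ENNReal.Tendsto.const_mul (a := eLpNorm R (ENNReal.ofReal r) μ *
      eLpNorm (fun z => ω z * u z) (ENNReal.ofReal q) μ ^ (p - 1))
      (h.tendsto_eLpNorm_mul_sub hp1.le hC hωm hHS) (Or.inr (ENNReal.mul_ne_top hR.eLpNorm_ne_top
        (ENNReal.rpow_ne_top_of_nonneg (by linarith) hωu_fin)))
    have t2 := ENNReal.Tendsto.const_mul (a := eLpNorm V₀ (ENNReal.ofReal m) μ)
      (h.tendsto_eLpNorm_mul_sub hp1.le hS measurable_const hSob') (Or.inr hVm.eLpNorm_ne_top)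
    have t := t1.add t2
    rw [mul_zero, mul_zero, add_zero] at t
    refine tendsto_of_tendsto_of_tendsto_of_le_of_le tendsto_const_nhds t (fun _ => zero_le)
      fun j => (hlintg _ (hym j)).trans (add_le_add ?_ ?_)
    · rw [mul_assoc]
      exact lintegral_enorm_mul_rpow_mul_le hR.1 hωu (hωm.aestronglyMeasurable.mul (hym j)) hr0 hq
        hp1.le hqr
    · simp only [one_mul]
      exact lintegral_enorm_mul_le hV₁.1 (hym j) (by linarith) hP0 hmP
  -- Choice of the level `η` below which the potential term is absorbed.
  set K := ENNReal.ofReal (4 ^ p / a) with hK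
  obtain ⟨N, hN⟩ : ∃ N : ℕ, eLpNorm
      (fun z => (Set.Ioo 0 (1 / ((N : ℝ) + 1))).indicator (1 : ℝ → ℝ) (u z) * R z)
      (ENNReal.ofReal r) μ * (C ^ p * K) ≤ 2⁻¹ := by
    have := ENNReal.Tendsto.mul_const (b := C ^ p * K) (tendsto_eLpNorm_indicator_mul hr0 hR hum)
      (Or.inr (ENNReal.mul_ne_top (ENNReal.rpow_ne_top_of_nonneg hp0.le hC)
        ENNReal.ofReal_ne_top))
    rw [zero_mul] at this
    exact (this.eventually_le_const (by simp)).exists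
  set η : ℝ := 1 / ((N : ℝ) + 1) with hη
  have hη0 : 0 < η := by positivity
  set Rη : EuclideanSpace ℝ (Fin n) → ℝ :=
    fun z => (Set.Ioo 0 η).indicator (1 : ℝ → ℝ) (u z) * R z with hRη
  have hRηm : AEStronglyMeasurable Rη μ :=
    (((measurable_one.indicator measurableSet_Ioo).comp_aemeasurable
      hum.aemeasurable).aestronglyMeasurable).mul hR.1
  set M₀ : ENNReal := ENNReal.ofReal (η ^ (a - 1)) *
      (∫⁻ z, ‖R z‖ₑ * (‖ω z * u z‖ₑ ^ (p - 1) * ‖ω z * u z‖ₑ) ∂μ) +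
    ∫⁻ z, ‖V₀ z‖ₑ * (1 + ‖u z‖ₑ) ∂μ with hM₀
  have hM₀_fin : M₀ ≠ ⊤ := by
    refine ENNReal.add_ne_top.2 ⟨ENNReal.mul_ne_top ENNReal.ofReal_ne_top ?_, ?_⟩
    · exact ne_top_of_le_ne_top (ENNReal.mul_ne_top hR.eLpNorm_ne_top (ENNReal.mul_ne_top
        (ENNReal.rpow_ne_top_of_nonneg (by linarith) hωu_fin) hωu_fin))
        (lintegral_enorm_mul_rpow_mul_le hR.1 hωu hωu hr0 hq hp1.le hqr)
    · simp_rw [mul_add, mul_one]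
      rw [lintegral_add_left' hV₁.1.enorm, ← eLpNorm_one_eq_lintegral_enorm]
      exact ENNReal.add_ne_top.2 ⟨hV₁.eLpNorm_ne_top, ne_top_of_le_ne_top
        (ENNReal.mul_ne_top hVm.eLpNorm_ne_top hu_fin)
        (lintegral_enorm_mul_le hV₁.1 hum (by linarith) hP0 hmP)⟩
  refine ⟨2 * M₀, ENNReal.mul_ne_top (by simp) hM₀_fin, fun d hd => ?_⟩
  set A := ∫⁻ z, ENNReal.ofReal (testProfileDeriv a d (u z) * ‖G z‖ ^ p) ∂μ with hA
  have hfm : AEStronglyMeasurable (fun z => testProfile a d (u z)) μ :=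
    (contDiff_testProfile (m := 1) hd).continuous.comp_aestronglyMeasurable hum
  have hint : Integrable (fun z => testProfileDeriv a d (u z) * ‖G z‖ ^ p) μ := by
    have h1 : Integrable (fun z => ‖G z‖ ^ p) μ := by
      have := hG.memLp.integrable_norm_rpow (by simpa using hp0) ENNReal.ofReal_ne_top
      rwa [ENNReal.toReal_ofReal hp0.le] at this
    have h2 : Continuous (testProfileDeriv a d) := by
      have := (contDiff_testProfile (a := a) (m := 1) hd).continuous_deriv_one
      rwa [show deriv (testProfile a d) = testProfileDeriv a d from
        funext fun t => deriv_testProfile hd t] at this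
    exact h1.bdd_mul (h2.comp_aestronglyMeasurable hum)
      (ae_of_all _ fun z => abs_testProfileDeriv_le ha ha1 hd (u z))
  have hA_eq : A = ENNReal.ofReal (∫ z, testProfileDeriv a d (u z) * ‖G z‖ ^ p ∂μ) := by
    rw [hA, ofReal_integral_eq_lintegral_ofReal hint (hu0.mono fun z hz =>
      mul_nonneg (testProfileDeriv_nonneg ha hd hz) (by positivity))]
  have hA_fin : A ≠ ⊤ := by rw [hA_eq]; exact ENNReal.ofReal_ne_top
  have hA_le : A ≤ ∫⁻ z, ‖g z‖ₑ * ‖testProfile a d (u z)‖ₑ ∂μ := by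
    have := ofReal_integral_deriv_mul_le hp1 hgm hG.memLp hφ hlim hsub hconv
      (F := testProfile a d) (contDiff_testProfile hd) testProfile_zero (testProfile_nonneg ha hd)
      (fun t => by rw [deriv_testProfile hd]; exact abs_testProfileDeriv_le ha ha1 hd t)
    simp_rw [deriv_testProfile hd] at this
    rwa [hA_eq]
  set Y := eLpNorm (fun z => ω z * powerProfile p a d (u z)) (ENNReal.ofReal q) μ with hY
  have hY_le : Y ^ (p - 1) * Y ≤ C ^ p * K * A := by
    have h1 : Y ≤ _ := (hlim.comp hp1.le hG.memLp (contDiff_powerProfile hp1 hd)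
      (powerProfile_zero hp1) (abs_deriv_powerProfile_le_const hp1 ha ha1 hd)).eLpNorm_mul_le
      hp1.le hC hωm hHS
    have h2 : Y ^ (p - 1) * Y = Y ^ p := by
      nth_rewrite 2 [← ENNReal.rpow_one Y]
      rw [← ENNReal.rpow_add_of_nonneg _ _ (by linarith) zero_le_one, sub_add_cancel]
    rw [h2, mul_assoc]
    refine (ENNReal.rpow_le_rpow h1 hp0.le).trans ?_
    rw [ENNReal.mul_rpow_of_nonneg _ _ hp0.le]
    exact mul_le_mul' le_rfl (eLpNorm_deriv_powerProfile_smul_rpow_le hp1 ha ha1 hd hu0)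
  have hωW : AEStronglyMeasurable (fun z => ω z * powerProfile p a d (u z)) μ :=
    hωm.aestronglyMeasurable.mul
      ((contDiff_powerProfile hp1 hd).continuous.comp_aestronglyMeasurable hum)
  have hlow : ∫⁻ z, ‖Rη z‖ₑ * (‖ω z * powerProfile p a d (u z)‖ₑ ^ (p - 1) *
      ‖ω z * powerProfile p a d (u z)‖ₑ) ∂μ ≤ A / 2 := by
    refine (lintegral_enorm_mul_rpow_mul_le hRηm hωW hωW hr0 hq hp1.le hqr).trans ?_
    calc _ ≤ eLpNorm Rη (ENNReal.ofReal r) μ * (C ^ p * K * A) := mul_le_mul' le_rfl hY_le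
      _ = eLpNorm Rη (ENNReal.ofReal r) μ * (C ^ p * K) * A := by ring
      _ ≤ 2⁻¹ * A := mul_le_mul' hN le_rfl
      _ = A / 2 := by rw [mul_comm, div_eq_mul_inv]
  have hsum : A ≤ A / 2 + M₀ := by
    refine (hA_le.trans (hlintg _ hfm)).trans ?_
    have h1 : ∫⁻ z, ‖R z‖ₑ * (‖ω z * u z‖ₑ ^ (p - 1) * ‖ω z * testProfile a d (u z)‖ₑ) ∂μ ≤
        A / 2 + ENNReal.ofReal (η ^ (a - 1)) *
          ∫⁻ z, ‖R z‖ₑ * (‖ω z * u z‖ₑ ^ (p - 1) * ‖ω z * u z‖ₑ) ∂μ := by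
      rw [← lintegral_const_mul' _ _ ENNReal.ofReal_ne_top]
      refine le_trans (lintegral_mono_ae (hu0.mono fun z hz =>
        enorm_potential_le hp1 ha ha1 hd hη0 (hω0 z) hz)) ?_
      refine (le_of_eq (lintegral_add_left' ?_ _)).trans (add_le_add hlow le_rfl)
      exact hRηm.enorm.mul ((hωW.enorm.pow_const _).mul hωW.enorm)
    have h2 : ∫⁻ z, ‖V₀ z‖ₑ * ‖testProfile a d (u z)‖ₑ ∂μ ≤ ∫⁻ z, ‖V₀ z‖ₑ * (1 + ‖u z‖ₑ) ∂μ :=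
      lintegral_mono_ae (hu0.mono fun z hz =>
        mul_le_mul' le_rfl (enorm_testProfile_le ha ha1 hd hz))
    refine (add_le_add h1 h2).trans (le_of_eq ?_)
    rw [hM₀, add_assoc]
  have hhalf : A / 2 ≤ M₀ := by
    have hfin : A / 2 ≠ ⊤ := ENNReal.div_ne_top hA_fin (by simp)
    refine (ENNReal.add_le_add_iff_left hfin).1 ?_
    rwa [ENNReal.add_halves]
  calc A = 2 * (A / 2) := (ENNReal.mul_div_cancel (by simp) (by simp)).symm
    _ ≤ 2 * M₀ := mul_le_mul' le_rfl hhalf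

theorem theorem2p3 (n k : ℕ) (hn : 3 ≤ n) (hk2 : 2 ≤ k) (hkn : k ≤ n)
    (p s : ℝ) (hp1 : 1 < p) (hpn : p < n) (hs0 : 0 ≤ s) (hsp : s < p) (hsk : s < k)
    (hbound : s * ((n : ℝ) - k) < k * ((n : ℝ) - p))
    (Ω : Set (EuclideanSpace ℝ (Fin n))) (hΩ : IsOpen Ω)
    (R V₀ u : EuclideanSpace ℝ (Fin n) → ℝ)
    (hR : MemLp R (ENNReal.ofReal (rPrime n p s)) (volume.restrict Ω))
    (hV₁ : MemLp V₀ 1 (volume.restrict Ω))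
    (hVr : MemLp V₀ (ENNReal.ofReal (rPrime n p s)) (volume.restrict Ω))
    (hsign : 2 < p → (∀ᵐ z ∂(volume.restrict Ω), 0 ≤ R z) ∧
      (∀ᵐ z ∂(volume.restrict Ω), 0 ≤ V₀ z))
    (hu0 : ∀ᵐ z ∂(volume.restrict Ω), 0 ≤ u z)
    (hub : IsLocallyBounded Ω u)
    (hu : IsWeakSubsolution Ω k p s R V₀ u) :
    ∀ q : ℝ, sobolevConj n p / holderConj p < q → q ≤ sobolevConj n p →
      MemLp u (ENNReal.ofReal q) (volume.restrict Ω) := by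
  intro q hq1 hq2
  have hp0 : 0 < p := by linarith
  have hP0 : 0 < sobolevConj n p := div_pos (mul_pos (by linarith) hp0) (by linarith)
  obtain ⟨G, hG, hsub⟩ := hu
  have hum : AEStronglyMeasurable u (volume.restrict Ω) :=
    hG.weakGrad.locInt.aestronglyMeasurable
  set P := sobolevConj n p with hP
  -- The exponent `a` for which `q = p* (p - 1 + a) / p`.
  set a := p * q / P - (p - 1) with ha_def
  have ha : 0 < a := by
    rw [ha_def, sub_pos, lt_div_iff₀ hP0]
    rw [holderConj, div_div_eq_mul_div, div_lt_iff₀ hp0] at hq1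
    linarith
  have ha1 : a ≤ 1 := by
    rw [ha_def, sub_le_iff_le_add, div_le_iff₀ hP0]
    nlinarith
  have hγ : (p - 1 + a) / p * P = q := by
    rw [ha_def]; field_simp; ring
  have hγ0 : 0 < (p - 1 + a) / p := div_pos (by linarith) hp0
  have hq0 : 0 < q := by rw [← hγ]; positivity
  obtain ⟨M, hM, hbd⟩ := exists_energy_bound hk2 hkn hp1 hpn hs0 hsp hbound hΩ hR hV₁ hVr hu0 hG
    hsub ha ha1
  obtain ⟨φ, -, hlim⟩ := hG.exists_isGradLimit hΩ
  obtain ⟨S, hS, hSob⟩ := sobolev_fderiv (n := n) hp1 hpn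
  have hSob' : ∀ w : EuclideanSpace ℝ (Fin n) → ℝ, ContDiff ℝ 1 w → HasCompactSupport w →
      eLpNorm (fun z => (1 : ℝ) * w z) (ENNReal.ofReal P) volume ≤
        S * eLpNorm (fderiv ℝ w) (ENNReal.ofReal p) volume := by simpa using hSob
  have hWbd : ∀ j : ℕ, eLpNorm (fun z => powerProfile p a (1 / ((j : ℝ) + 1)) (u z))
      (ENNReal.ofReal P) (volume.restrict Ω) ≤ S * (ENNReal.ofReal (4 ^ p / a) * M) ^ (1 / p) := by
    intro j
    have hd : (0 : ℝ) < 1 / ((j : ℝ) + 1) := by positivity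
    have h1 := (hlim.comp hp1.le hG.memLp (contDiff_powerProfile hp1 hd)
      (powerProfile_zero hp1) (abs_deriv_powerProfile_le_const hp1 ha ha1 hd)).eLpNorm_mul_le
      hp1.le hS measurable_const hSob'
    simp only [one_mul] at h1
    refine h1.trans (mul_le_mul' le_rfl ?_)
    rw [one_div p, ENNReal.le_rpow_inv_iff hp0]
    exact (eLpNorm_deriv_powerProfile_smul_rpow_le hp1 ha ha1 hd hu0).trans
      (mul_le_mul' le_rfl (hbd _ hd))
  have hfatou := Lp.eLpNorm_lim_le_liminf_eLpNorm (p := ENNReal.ofReal P)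
    (μ := volume.restrict Ω) (f := fun (j : ℕ) z => powerProfile p a (1 / ((j : ℝ) + 1)) (u z))
    (fun j => (contDiff_powerProfile hp1 (by positivity)).continuous.comp_aestronglyMeasurable hum)
    (fun z => u z ^ ((p - 1 + a) / p)) (hu0.mono fun z hz => tendsto_powerProfile hp1 ha hz)
  have hfin : eLpNorm (fun z => u z ^ ((p - 1 + a) / p)) (ENNReal.ofReal P) (volume.restrict Ω)
      ≠ ⊤ := by
    have hB : S * (ENNReal.ofReal (4 ^ p / a) * M) ^ (1 / p) ≠ ⊤ :=
      ENNReal.mul_ne_top hS (ENNReal.rpow_ne_top_of_nonneg (by positivity)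
        (ENNReal.mul_ne_top ENNReal.ofReal_ne_top hM))
    refine ne_top_of_le_ne_top hB (hfatou.trans ?_)
    exact liminf_le_of_le (by isBoundedDefault) fun b hb => by
      obtain ⟨j, hj⟩ := hb.exists
      exact hj.trans (hWbd j)
  refine ⟨hum, ?_⟩
  rw [eLpNorm_ofReal_eq u hq0]
  refine ENNReal.rpow_lt_top_of_nonneg (by positivity) ?_
  have hpow := ENNReal.rpow_ne_top_of_nonneg hP0.le hfin
  rw [eLpNorm_ofReal_rpow _ hP0] at hpow
  refine ne_top_of_le_ne_top hpow (lintegral_mono_ae (hu0.mono fun z hz => le_of_eq ?_))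
  rw [Real.enorm_of_nonneg hz, Real.enorm_of_nonneg (Real.rpow_nonneg hz _),
    ← ENNReal.ofReal_rpow_of_nonneg hz hγ0.le, ← ENNReal.rpow_mul, hγ]
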